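/- **Theorem 4.** Let $Q<0$, $A,B\in\mathbb R$, $\alpha,\beta\in\{1,-1\}$ and $N\in\mathbb Z_{\ge0}$. For $\varepsilon>0$ put $q=e^{Q/\varepsilon}$, $c_1=\alpha e^{A/\varepsilon}$, $c_2=\beta e^{B/\varepsilon}$, and for $m\in\mathbb Z$ let $w(m)=c_1a(m)+c_2b(m)$, where $$a(m)=(-1)^{m(m-1)/2}\sum_{n\ge0}\frac{(-1)^n(-q)^{n(n+1)/2}}{(q^2;q^2)_n}(-q)^{mn},\qquad b(m)=(-1)^{m(m+1)/2}\sum_{n\ge0}\frac{(-q)^{n(n+1)/2}}{(q^2;q^2)_n}(-q)^{mn}$$ are the $q$-Ai and $q$-Bi functions at $\tau=q^m$, and $(q^2;q^2)_n=\prod_{i=1}^n(1-q^{2i})$. Let $g^{(n)}(m)=\det\bigl(w(m-i+2j)\bigr)_{0\le i,j\le n-1}$ (with $g^{(0)}=1$), and let $$z^{(N)}(m)=\frac{g^{(N)}(m)\,g^{(N+1)}(m+1)}{q^N g^{(N)}(m+1)\,g^{(N+1)}(m)}$$ be the corresponding determinant expression (the determinant form of the solutions of $q$-PII, $(z(q\tau)z(\tau)+1)(z(\tau)z(q^{-1}\tau)+1)=\frac{a\tau^2z(\tau)}{\tau-z(\tau)}$,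 with $a=q^{2N+1}$, $\tau=q^m$). We say that $(\zeta,Z)$ is the p-ultradiscrete limit of $z^{(N)}(m)$ if for all sufficiently small $\varepsilon>0$ one has $z^{(N)}(m)\ne0$ and $z^{(N)}(m)/|z^{(N)}(m)|=\zeta$, and $\varepsilon\log|z^{(N)}(m)|\to Z$ as $\varepsilon\to+0$. Let $m_0$ be an integer with $m_0\le\min(-3N-2,-N(N+1)/2-1)$ and $m_0^2Q\le B-A<(m_0+1)^2Q$. Put $P_0=(m_0+1)^2Q$, $P_j=(m_0^2-(N-j+1)(N-j+2))Q$ for $1\le j\le N+1$, and let $k_0\in\{0,\dots,N\}$ satisfy $P_{k_0+1}\le B-A<P_{k_0}$. Then for every integer $m\le-2N-1$ the p-ultradiscrete limit $(\zeta^{(N)}(m),Z^{(N)}(m))$ of $z^{(N)}(m)$ exists and is given as follows. (I) If $m\le m_0-2N-1$, it is $(+1,(-m-2N-1)Q)$. (II) If $m_0-2N\le m\le m_0+N-3k_0+1$, it is $$\begin{cases}(\alpha\beta(-1)^j,\ A-B+(m_0^2+m_0-j^2)Q)&(m=m_0-2N+3j,\ 0\le j\le N-k_0)\\(+1,\ (m_0+j+1)Q)&(m=m_0-2N+3j+1,\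 0\le j\le N-k_0)\\(\alpha\beta(-1)^j,\ B-A-(m_0^2+m_0-(j+1)^2)Q)&(m=m_0-2N+3j+2,\ 0\le j\le N-k_0-1).\end{cases}$$ (III) If $k_0\ne0$ and $m=m_0+N-3k_0+2$, it is $(-1,(-m_0-N+k_0-1)Q)$. (IV) If $k_0\ne0$ and $m_0+N-3k_0+3\le m\le m_0+N$, it is $$\begin{cases}(+1,\ (m_0+j)Q)&(m=m_0-2N+3j,\ N-k_0+1\le j\le N)\\(\alpha\beta(-1)^j,\ B-A-(m_0^2-m_0-(j+1)^2)Q)&(m=m_0-2N+3j+1,\ N-k_0+1\le j\le N-1)\\(\alpha\beta(-1)^{j+1},\ A-B+(m_0^2-m_0-(j+1)^2)Q)&(m=m_0-2N+3j+2,\ N-k_0+1\le j\le N-1).\end{cases}$$ (V) If $m_0+N+1\le m\le-2N-1$, it is $(+1,mQ)$. -/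

import Mathlib

open Filter Topology

noncomputable section

/-- The `q`-shifted factorial `(q²; q²)_n = (1 - q²)(1 - q⁴) ⋯ (1 - q^{2n})`. -/
def qSqFactorial (q : ℝ) (n : ℕ) : ℝ :=
  ∏ i ∈ Finset.range n, (1 - q ^ (2 * (i + 1)))

/-- The `q`-Airy function `q`-Ai at `τ = q ^ m`. All integer divisions by `2` are exact,
and for `0 < q < 1` the series converges absolutely. -/
def qAi (q : ℝ) (m : ℤ) : ℝ :=
  (-1 : ℝ) ^ (m * (m - 1) / 2) *
    ∑' n : ℕ, (-1 : ℝ) ^ n * (-q) ^ (n * (n + 1) / 2) / qSqFactorial q n * (-q) ^ (m * (n : ℤ))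

/-- The `q`-Airy function `q`-Bi at `τ = q ^ m`. -/
def qBi (q : ℝ) (m : ℤ) : ℝ :=
  (-1 : ℝ) ^ (m * (m + 1) / 2) *
    ∑' n : ℕ, (-q) ^ (n * (n + 1) / 2) / qSqFactorial q n * (-q) ^ (m * (n : ℤ))

/-- The seed `w(m) = c₁ q-Ai(q^m) + c₂ q-Bi(q^m)`. -/
def airySeed (q c₁ c₂ : ℝ) (m : ℤ) : ℝ :=
  c₁ * qAi q m + c₂ * qBi q m

/-- The `N × N` determinant `g^{(N)}(q^m)` of the seed `w`, with `(i, j)` entry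
`w(q^{m - i + 2 j})`, `0 ≤ i, j ≤ N - 1`; it is `1` for `N = 0`. -/
def airyDet (w : ℤ → ℝ) (N : ℕ) (m : ℤ) : ℝ :=
  Matrix.det (Matrix.of fun i j : Fin N => w (m - (i : ℤ) + 2 * (j : ℤ)))

/-- The determinant expression `z^{(N)}(q^m)` for the solution of `q`-PII with `a = q^{2N+1}`
that has the seed `w`. -/
def detSolution (q : ℝ) (w : ℤ → ℝ) (N : ℕ) (m : ℤ) : ℝ :=
  airyDet w N m * airyDet w (N + 1) (m + 1) /
    (q ^ N * airyDet w N (m + 1) * airyDet w (N + 1) m)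

/-- The determinant solution as a function of `ε`, where `q = e^{Q/ε}`, `c₁ = α e^{A/ε}`
and `c₂ = β e^{B/ε}`. -/
def detSolutionEps (Q A B α β : ℝ) (N : ℕ) (m : ℤ) (ε : ℝ) : ℝ :=
  detSolution (Real.exp (Q / ε))
    (airySeed (Real.exp (Q / ε)) (α * Real.exp (A / ε)) (β * Real.exp (B / ε))) N m

/-- The family `z(ε)`, `ε > 0`, has the p-ultradiscrete limit `(ζ, Z)`: for all small `ε > 0`
it does not vanish and its sign is `ζ`, and its amplitude variable `ε log |z(ε)|`
tends to `Z` as `ε → +0`. -/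
def HasPUltradiscreteLimit (z : ℝ → ℝ) (ζ Z : ℝ) : Prop :=
  (∀ᶠ ε in 𝓝[>] (0 : ℝ), z ε ≠ 0 ∧ z ε / |z ε| = ζ) ∧
    Tendsto (fun ε : ℝ => ε * Real.log |z ε|) (𝓝[>] (0 : ℝ)) (𝓝 Z)

/-- The thresholds `P_0 = (m₀ + 1)² Q` and
`P_j = (m₀² - (N - j + 1)(N - j + 2)) Q` for `j ≥ 1`. -/
def thresholdP (Q : ℝ) (N : ℕ) (m₀ : ℤ) (j : ℕ) : ℝ :=
  if j = 0 then ((m₀ : ℝ) + 1) ^ 2 * Q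
  else ((m₀ : ℝ) ^ 2 - ((N : ℝ) - j + 1) * ((N : ℝ) - j + 2)) * Q

end

/-! For `q = e^{Q/ε}` with `Q < 0` every quantity here has the form `(c + o(1)) e^{E/ε}`
(`HasLeadingTerm`), and the proof finds the pair `(c, E)` for each determinant in `z^{(N)}(m)`.

*Seed.* At `τ = q^x` with `x ≤ 0`, `q`-Bi behaves like `2 q^{-x(x+1)/2}` for `x < 0`, directly from
two equal leading terms of its series. In the series of `q`-Ai these terms, and many more, cancel.
With `p = -q` the series is rearranged into a sum of infinite products `(p^{x+k+1}; p)_∞`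
(`eulerSeries_mul_tsum`) that vanish for `k < -x`, which shows that `q`-Ai behaves like
`q^{x(x-1)/2}`.

*Determinants.* In the Leibniz expansion of `det w(m - i + 2j)` both summands of `w` are multiplied
out. If all arguments `x = m - i + 2j` are nonpositive, an exchange argument (`pair_of_maximal`)
shows that a term with maximal exponent is one of the terms `blockTerm n k`, `0 ≤ k ≤ n`, in
which `q`-Bi occupies the first `k` columns and last `k` rows along the antidiagonal and `q`-Ai the
remaining block along its diagonal. The exponent of `blockTerm n k` is strictly concave in `k`, so
its maximum is attained at one `k` or at two consecutive ones. In the second case the two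
coefficients have absolute values `2^{k-1}` and `2^k`, so that nothing cancels
(`exists_hasLeadingTerm_airyDet`).

*Conclusion.* The hypotheses on `m₀` and `k₀` say where the maximum is attained
(`blockDominates_of_thresholds`). In each of the cases of the theorem this gives the number of
factors `q`-Ai in the dominating terms of the four determinants, and sign and exponent of
`z^{(N)}(m)` follow by algebra.
-/

/-! ### Euler's series and the `q`-Airy series -/

noncomputable section

/-- The `q`-shifted factorial `(p; p)_n = (1 - p)(1 - p²) ⋯ (1 - pⁿ)`. -/
def qPochhammer (p : ℝ) (n : ℕ) : ℝ :=
  ∏ i ∈ Finset.range n, (1 - p ^ (i + 1))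

/-- The coefficient `p^{n(n-1)/2} / (p; p)_n` of Euler's series. -/
def eulerCoeff (p : ℝ) (n : ℕ) : ℝ :=
  p ^ n.choose 2 / qPochhammer p n

/-- Euler's series `∑ p^{n(n-1)/2} zⁿ / (p; p)_n`, which sums to the infinite product
`(-z; p)_∞`; only the functional equation of the product is used. -/
def eulerSeries (p z : ℝ) : ℝ :=
  ∑' n : ℕ, eulerCoeff p n * z ^ n

end

lemma qPochhammer_succ (p : ℝ) (n : ℕ) :
    qPochhammer p (n + 1) = qPochhammer p n * (1 - p ^ (n + 1)) := by
  simp [qPochhammer, Finset.prod_range_succ]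

lemma abs_pow_succ_le {p : ℝ} (hp : |p| ≤ 1 / 4) (n : ℕ) : |p ^ (n + 1)| ≤ 1 / 4 := by
  rw [abs_pow, pow_succ]
  have h1 : |p| ^ n ≤ 1 := pow_le_one₀ (abs_nonneg p) (by linarith)
  nlinarith [abs_nonneg p, pow_nonneg (abs_nonneg p) n]

lemma half_pow_le_abs_qPochhammer {p : ℝ} (hp : |p| ≤ 1 / 4) (n : ℕ) :
    (1 / 2 : ℝ) ^ n ≤ |qPochhammer p n| := by
  induction n with
  | zero => simp [qPochhammer]
  | succ n ih =>
    rw [qPochhammer_succ, abs_mul, pow_succ]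
    have h1 := abs_le.1 (abs_pow_succ_le hp n)
    have h2 : (1 / 2 : ℝ) ≤ |1 - p ^ (n + 1)| := by
      rw [abs_of_pos (by linarith)]
      linarith
    exact mul_le_mul ih h2 (by norm_num) (abs_nonneg _)

lemma qPochhammer_ne_zero {p : ℝ} (hp : |p| ≤ 1 / 4) (n : ℕ) : qPochhammer p n ≠ 0 := by
  have := half_pow_le_abs_qPochhammer hp n
  intro h
  rw [h, abs_zero] at this
  exact absurd this (not_le.2 (by positivity))

lemma abs_eulerCoeff_le {p : ℝ} (hp : |p| ≤ 1 / 4) (n : ℕ) :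
    |eulerCoeff p n| ≤ (1 / 4) ^ n.choose 2 * 2 ^ n := by
  have h := half_pow_le_abs_qPochhammer hp n
  have h1 : |p| ^ n.choose 2 ≤ (1 / 4) ^ n.choose 2 := pow_le_pow_left₀ (abs_nonneg p) hp _
  rw [eulerCoeff, abs_div, abs_pow]
  calc |p| ^ n.choose 2 / |qPochhammer p n| ≤ (1 / 4) ^ n.choose 2 / (1 / 2) ^ n := by gcongr
    _ = (1 / 4) ^ n.choose 2 * 2 ^ n := by
      rw [one_div_pow 2 n, div_div_eq_mul_div, div_one]

lemma summable_quarter_pow_choose_mul_pow (y : ℝ) :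
    Summable fun n : ℕ => (1 / 4 : ℝ) ^ n.choose 2 * y ^ n := by
  have hlim : Tendsto (fun n : ℕ => (1 / 4 : ℝ) ^ n * |y|) atTop (𝓝 0) := by
    simpa using (tendsto_pow_atTop_nhds_zero_of_lt_one (r := (1 / 4 : ℝ))
      (by norm_num) (by norm_num)).mul_const |y|
  refine summable_of_ratio_norm_eventually_le (r := 1 / 2) (by norm_num) ?_
  filter_upwards [hlim.eventually_le_const (by norm_num : (0 : ℝ) < 1 / 2)] with n hn
  have : (n + 1).choose 2 = n + n.choose 2 := by
    rw [Nat.choose_succ_succ' n 1, Nat.choose_one_right]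
  rw [this, Real.norm_eq_abs, Real.norm_eq_abs, pow_add, pow_succ y,
    show (1 / 4 : ℝ) ^ n * (1 / 4) ^ n.choose 2 * (y ^ n * y)
      = ((1 / 4 : ℝ) ^ n * y) * ((1 / 4) ^ n.choose 2 * y ^ n) by ring, abs_mul, abs_mul _ y,
    abs_of_nonneg (by positivity : (0 : ℝ) ≤ (1 / 4) ^ n)]
  exact mul_le_mul_of_nonneg_right hn (abs_nonneg _)

lemma abs_eulerCoeff_mul_pow_le {p : ℝ} (hp : |p| ≤ 1 / 4) (z : ℝ) (n : ℕ) :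
    |eulerCoeff p n * z ^ n| ≤ (1 / 4) ^ n.choose 2 * (2 * |z|) ^ n := by
  rw [abs_mul, abs_pow, mul_pow, ← mul_assoc]
  exact mul_le_mul_of_nonneg_right (abs_eulerCoeff_le hp n) (by positivity)

lemma summable_eulerCoeff_mul_pow {p : ℝ} (hp : |p| ≤ 1 / 4) (z : ℝ) :
    Summable fun n : ℕ => eulerCoeff p n * z ^ n :=
  Summable.of_norm_bounded (summable_quarter_pow_choose_mul_pow (2 * |z|))
    fun n => abs_eulerCoeff_mul_pow_le hp z n

lemma one_sub_mul_eulerCoeff_succ {p : ℝ} (hp : |p| ≤ 1 / 4) (n : ℕ) :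
    (1 - p ^ (n + 1)) * eulerCoeff p (n + 1) = p ^ n * eulerCoeff p n := by
  have h0 := qPochhammer_ne_zero hp n
  have h1 := qPochhammer_ne_zero hp (n + 1)
  rw [qPochhammer_succ] at h1
  have h2 : 1 - p ^ (n + 1) ≠ 0 := right_ne_zero_of_mul h1
  rw [eulerCoeff, eulerCoeff, qPochhammer_succ, Nat.choose_succ_succ' n 1, Nat.choose_one_right,
    pow_add p n (n.choose (1 + 1))]
  generalize 1 - p ^ (n + 1) = t at *
  field_simp

/-- The functional equation `(-z; p)_∞ = (1 + z) (-pz; p)_∞`. -/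
lemma eulerSeries_eq {p : ℝ} (hp : |p| ≤ 1 / 4) (z : ℝ) :
    eulerSeries p z = (1 + z) * eulerSeries p (p * z) := by
  have hs := summable_eulerCoeff_mul_pow hp z
  have hs' := summable_eulerCoeff_mul_pow hp (p * z)
  have key : eulerSeries p z - eulerSeries p (p * z) = z * eulerSeries p (p * z) := by
    rw [eulerSeries, eulerSeries, ← hs.tsum_sub hs', (hs.sub hs').tsum_eq_zero_add, ← tsum_mul_left]
    simp only [pow_zero, sub_self, zero_add]
    refine tsum_congr fun n => ?_
    have := one_sub_mul_eulerCoeff_succ hp n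
    rw [mul_pow, mul_pow]
    linear_combination z ^ (n + 1) * this
  linarith

/-- The zeros `z = -p^{-j}` of the infinite product `(-z; p)_∞`. -/
lemma eulerSeries_neg_inv_pow {p : ℝ} (hp : |p| ≤ 1 / 4) (h0 : p ≠ 0) (j : ℕ) :
    eulerSeries p (-(p⁻¹) ^ j) = 0 := by
  induction j with
  | zero => rw [eulerSeries_eq hp]; simp
  | succ j ih =>
    rw [eulerSeries_eq hp, show p * -(p⁻¹) ^ (j + 1) = -(p⁻¹) ^ j by
      rw [pow_succ]; field_simp, ih, mul_zero]

lemma prod_mul_eulerSeries_pow_succ {p : ℝ} (hp : |p| ≤ 1 / 4) (n : ℕ) :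
    (∏ i ∈ Finset.range n, (1 + p ^ (i + 1))) * eulerSeries p (p ^ (n + 1)) = eulerSeries p p := by
  induction n with
  | zero => simp
  | succ n ih =>
    rw [← ih, eulerSeries_eq hp (p ^ (n + 1)), Finset.prod_range_succ, pow_succ' p (n + 1)]
    ring

lemma qSqFactorial_neg (p : ℝ) (n : ℕ) :
    qSqFactorial (-p) n = qPochhammer p n * ∏ i ∈ Finset.range n, (1 + p ^ (i + 1)) := by
  rw [qSqFactorial, qPochhammer, ← Finset.prod_mul_distrib]
  refine Finset.prod_congr rfl fun i _ => ?_
  rw [(even_two_mul (i + 1)).neg_pow, mul_comm 2, pow_mul]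
  ring

lemma qSqFactorial_eq_qPochhammer (q : ℝ) (n : ℕ) :
    qSqFactorial q n = qPochhammer (q ^ 2) n := by
  simp only [qSqFactorial, qPochhammer, pow_mul]

lemma abs_sq_le_quarter {p : ℝ} (hp : |p| ≤ 1 / 4) : |p ^ 2| ≤ 1 / 4 :=
  abs_pow_succ_le hp 1

lemma qSqFactorial_ne_zero {p : ℝ} (hp : |p| ≤ 1 / 4) (n : ℕ) : qSqFactorial (-p) n ≠ 0 := by
  rw [qSqFactorial_eq_qPochhammer, neg_sq]
  exact qPochhammer_ne_zero (abs_sq_le_quarter hp) n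

/-- Expanding `1 / (p²; p²)_n = (-p^{n+1}; p)_∞ / ((-p; p)_∞ (p; p)_n)` by Euler's series and
exchanging the two sums turns the `q`-Airy series into a series of infinite products. -/
lemma eulerSeries_mul_tsum {p : ℝ} (hp : |p| ≤ 1 / 4) (x : ℝ) :
    eulerSeries p p * ∑' n : ℕ, p ^ (n + 1).choose 2 / qSqFactorial (-p) n * x ^ n
      = ∑' k : ℕ, p ^ (k + 1).choose 2 / qPochhammer p k * eulerSeries p (x * p ^ (k + 1)) := by
  have hch : ∀ n : ℕ, (n + 1).choose 2 = n + n.choose 2 := fun n => by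
    rw [Nat.choose_succ_succ' n 1, Nat.choose_one_right]
  have hp1 : |p| ≤ 1 := by linarith
  let T : ℕ → ℕ → ℝ := fun k n => eulerCoeff p k * p ^ k * (eulerCoeff p n * (x * p ^ (k + 1)) ^ n)
  have hT : Summable (Function.uncurry T) := by
    have hb := Summable.mul_of_nonneg (summable_quarter_pow_choose_mul_pow 2)
      (summable_quarter_pow_choose_mul_pow (2 * |x|)) (fun n => by positivity)
      (fun n => by positivity)
    refine Summable.of_norm_bounded hb fun ⟨k, n⟩ => ?_
    simp only [Function.uncurry, T, Real.norm_eq_abs]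
    rw [abs_mul]
    refine mul_le_mul ?_ ?_ (abs_nonneg _) (by positivity)
    · rw [abs_mul, abs_pow]
      exact (mul_le_of_le_one_right (abs_nonneg _) (pow_le_one₀ (abs_nonneg p) hp1)).trans
        (abs_eulerCoeff_le hp k)
    · refine (abs_eulerCoeff_mul_pow_le hp _ n).trans ?_
      have hx : |x * p ^ (k + 1)| ≤ |x| := by
        rw [abs_mul, abs_pow]
        exact mul_le_of_le_one_right (abs_nonneg _) (pow_le_one₀ (abs_nonneg p) hp1)
      gcongr
  have h1 : ∀ k, ∑' n, T k n
      = p ^ (k + 1).choose 2 / qPochhammer p k * eulerSeries p (x * p ^ (k + 1)) := fun k => by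
    rw [tsum_mul_left, eulerCoeff, eulerSeries, hch, pow_add]
    ring
  have h2 : ∀ n, ∑' k, T k n
      = eulerSeries p p * (p ^ (n + 1).choose 2 / qSqFactorial (-p) n * x ^ n) := fun n => by
    have h3 : ∀ k, T k n
        = eulerCoeff p n * x ^ n * p ^ n * (eulerCoeff p k * (p ^ (n + 1)) ^ k) := fun k => by
      simp only [T]
      ring
    have hne := qSqFactorial_ne_zero hp n
    rw [tsum_congr h3, tsum_mul_left, ← prod_mul_eulerSeries_pow_succ hp n, qSqFactorial_neg,
      eulerSeries, eulerCoeff, hch, pow_add]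
    rw [qSqFactorial_neg] at hne
    have ha := left_ne_zero_of_mul hne
    have hb := right_ne_zero_of_mul hne
    field_simp
    ring
  rw [← tsum_mul_left, ← tsum_congr h2, ← tsum_congr h1]
  exact hT.tsum_comm

/-! ### Asymptotics of `q`-Ai and `q`-Bi as `q → +0` -/

lemma continuous_qPochhammer (n : ℕ) : Continuous fun p : ℝ => qPochhammer p n := by
  unfold qPochhammer
  fun_prop

lemma qPochhammer_zero_left (n : ℕ) : qPochhammer 0 n = 1 := by
  simp [qPochhammer]

lemma tendsto_pow_div_qPochhammer (e n : ℕ) :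
    Tendsto (fun p : ℝ => p ^ e / qPochhammer p n) (𝓝 0) (𝓝 (0 ^ e)) := by
  have h : ContinuousAt (fun p : ℝ => p ^ e / qPochhammer p n) 0 :=
    (continuous_pow e).continuousAt.div (continuous_qPochhammer n).continuousAt
      (by simp [qPochhammer_zero_left])
  simpa [ContinuousAt, qPochhammer_zero_left] using h

lemma eventually_abs_le_quarter : ∀ᶠ p : ℝ in 𝓝 0, |p| ≤ 1 / 4 := by
  filter_upwards [Metric.closedBall_mem_nhds (0 : ℝ) (by norm_num : (0 : ℝ) < 1 / 4)] with p hp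
  simpa [Real.dist_eq] using hp

lemma abs_eulerSeries_le {p z : ℝ} (hp : |p| ≤ 1 / 4) (hz : |z| ≤ 1) :
    |eulerSeries p z| ≤ ∑' n : ℕ, (1 / 4 : ℝ) ^ n.choose 2 * 2 ^ n := by
  refine tsum_of_norm_bounded (f := fun n => eulerCoeff p n * z ^ n)
    (summable_quarter_pow_choose_mul_pow 2).hasSum fun n => ?_
  refine (abs_eulerCoeff_mul_pow_le hp z n).trans ?_
  have : 2 * |z| ≤ 2 := by linarith
  gcongr

lemma tendsto_eulerSeries {z : ℝ → ℝ} (hz : Tendsto z (𝓝 0) (𝓝 0)) :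
    Tendsto (fun p => eulerSeries p (z p)) (𝓝 0) (𝓝 1) := by
  have h1 : ∑' n : ℕ, (0 : ℝ) ^ n.choose 2 * 0 ^ n = 1 := by
    rw [tsum_eq_single 0 fun n hn => by simp [hn]]
    simp
  rw [← h1]
  refine tendsto_tsum_of_dominated_convergence (summable_quarter_pow_choose_mul_pow 2)
    (fun n => (tendsto_pow_div_qPochhammer _ n).mul (hz.pow n)) ?_
  filter_upwards [eventually_abs_le_quarter,
    hz.abs.eventually_le_const (by simp : |(0 : ℝ)| < 1)] with p hp hzp n
  refine (abs_eulerCoeff_mul_pow_le hp (z p) n).trans ?_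
  have : 2 * |z p| ≤ 2 := by linarith
  gcongr

lemma choose_two_add (a b : ℕ) : (a + b).choose 2 = a.choose 2 + b.choose 2 + a * b := by
  induction b with
  | zero => simp
  | succ b ih =>
    rw [← add_assoc, Nat.choose_succ_succ' (a + b) 1, Nat.choose_succ_succ' b 1,
      Nat.choose_one_right, Nat.choose_one_right, ih]
    ring

lemma two_mul_choose_two (n : ℕ) : 2 * (n.choose 2 : ℤ) = n * (n - 1) := by
  induction n with
  | zero => simp
  | succ n ih =>
    rw [Nat.choose_succ_succ' n 1, Nat.choose_one_right]
    push_cast at ih ⊢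
    linarith

lemma mul_succ_div_two_eq_choose (n : ℕ) : n * (n + 1) / 2 = (n + 1).choose 2 := by
  rw [Nat.choose_two_right, mul_comm, Nat.add_sub_cancel]

lemma neg_pow_mul_eq {p : ℝ} (M n : ℕ) : p ^ (-(M : ℤ) * (n : ℤ)) = (p⁻¹ ^ M) ^ n := by
  rw [zpow_mul, zpow_neg, zpow_natCast, zpow_natCast, inv_pow p M]

/-- The series for `q`-Ai at `τ = q^{-M}` with its first `M` terms, which are zero because of the
zeros of the infinite product, removed and the leading power of `q` taken out. -/
lemma eulerSeries_mul_qAi {p : ℝ} (hp : |p| ≤ 1 / 4) (h0 : p ≠ 0) (M : ℕ)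
    (hs : Summable fun l : ℕ => p ^ (l * (M + 1) + l.choose 2) / qPochhammer p (l + M) *
      eulerSeries p (-p ^ (l + 1))) :
    eulerSeries p p * qAi (-p) (-(M : ℤ)) = (-p) ^ (M + 1).choose 2 *
      ∑' l : ℕ, p ^ (l * (M + 1) + l.choose 2) / qPochhammer p (l + M) *
        eulerSeries p (-p ^ (l + 1)) := by
  have hsign : (-1 : ℝ) ^ (-(M : ℤ) * (-(M : ℤ) - 1) / 2) = (-1) ^ (M + 1).choose 2 := by
    rw [← zpow_natCast]
    congr 1
    have := two_mul_choose_two (M + 1)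
    push_cast at this
    rw [show -(M : ℤ) * (-(M : ℤ) - 1) = 2 * ((M + 1).choose 2 : ℕ) by rw [this]; ring]
    simp
  have hshift : ∀ l : ℕ, p ^ (l + M + 1).choose 2 / qPochhammer p (l + M) *
      eulerSeries p (-(p⁻¹) ^ M * p ^ (l + M + 1)) =
      p ^ (M + 1).choose 2 * (p ^ (l * (M + 1) + l.choose 2) / qPochhammer p (l + M) *
        eulerSeries p (-p ^ (l + 1))) := fun l => by
    rw [add_assoc, choose_two_add, show -(p⁻¹) ^ M * p ^ (l + (M + 1)) = -p ^ (l + 1) by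
      rw [inv_pow]; field_simp; ring]
    ring
  have hs' : Summable fun l : ℕ => p ^ (l + M + 1).choose 2 / qPochhammer p (l + M) *
      eulerSeries p (-(p⁻¹) ^ M * p ^ (l + M + 1)) := by
    simp only [hshift]
    exact hs.mul_left _
  have hterm : ∀ n : ℕ, (-1 : ℝ) ^ n * (- -p) ^ (n * (n + 1) / 2) / qSqFactorial (-p) n *
      (- -p) ^ (-(M : ℤ) * (n : ℤ)) =
      p ^ (n + 1).choose 2 / qSqFactorial (-p) n * (-(p⁻¹) ^ M) ^ n := fun n => by
    rw [neg_neg, neg_pow_mul_eq, mul_succ_div_two_eq_choose, neg_pow (p⁻¹ ^ M) n]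
    ring
  have hzero : ∀ k ∈ Finset.range M, p ^ (k + 1).choose 2 / qPochhammer p k *
      eulerSeries p (-(p⁻¹) ^ M * p ^ (k + 1)) = 0 := fun k hk => by
    obtain ⟨d, rfl⟩ := Nat.exists_eq_add_of_lt (Finset.mem_range.1 hk)
    have : -(p⁻¹) ^ (k + d + 1) * p ^ (k + 1) = -(p⁻¹) ^ d := by
      rw [inv_pow, inv_pow]
      field_simp
      ring
    rw [this, eulerSeries_neg_inv_pow hp h0, mul_zero]
  have hsum : ∑' k : ℕ, p ^ (k + 1).choose 2 / qPochhammer p k *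
      eulerSeries p (-(p⁻¹) ^ M * p ^ (k + 1)) = p ^ (M + 1).choose 2 *
        ∑' l : ℕ, p ^ (l * (M + 1) + l.choose 2) / qPochhammer p (l + M) *
          eulerSeries p (-p ^ (l + 1)) := by
    rw [← Summable.sum_add_tsum_nat_add' (f := fun k : ℕ => p ^ (k + 1).choose 2 /
      qPochhammer p k * eulerSeries p (-(p⁻¹) ^ M * p ^ (k + 1))) (k := M) hs',
      Finset.sum_eq_zero hzero, zero_add, tsum_congr hshift, tsum_mul_left]
  rw [qAi, hsign, tsum_congr hterm, mul_left_comm, eulerSeries_mul_tsum hp, hsum, neg_pow p,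
    mul_assoc]

/-- `q`-Ai is the recessive solution: `q`-Ai`(q^{-M}) ∼ q^{M(M+1)/2}` as `q → +0`. -/
lemma tendsto_qAi (M : ℕ) :
    Tendsto (fun q : ℝ => qAi q (-(M : ℤ)) / q ^ (M + 1).choose 2) (𝓝[>] 0) (𝓝 1) := by
  let K : ℝ := ∑' n : ℕ, (1 / 4 : ℝ) ^ n.choose 2 * 2 ^ n
  let f : ℝ → ℕ → ℝ := fun p l => p ^ (l * (M + 1) + l.choose 2) / qPochhammer p (l + M) *
    eulerSeries p (-p ^ (l + 1))
  have hbs : Summable fun l : ℕ => 2 ^ M * K * (1 / 2 : ℝ) ^ l :=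
    (summable_geometric_of_lt_one (by norm_num) (by norm_num)).mul_left _
  have hK : 0 ≤ K := tsum_nonneg fun n => by positivity
  have hbound : ∀ p : ℝ, |p| ≤ 1 / 4 → ∀ l, ‖f p l‖ ≤ 2 ^ M * K * (1 / 2 : ℝ) ^ l := by
    intro p hp l
    have h1 : |eulerSeries p (-p ^ (l + 1))| ≤ K := abs_eulerSeries_le hp (by
      rw [abs_neg]; exact (abs_pow_succ_le hp l).trans (by norm_num))
    have h2 := half_pow_le_abs_qPochhammer hp (l + M)
    have h3 : |p| ^ (l * (M + 1) + l.choose 2) ≤ (1 / 4) ^ l :=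
      (pow_le_pow_of_le_one (abs_nonneg p) (by linarith) (by nlinarith)).trans
        (pow_le_pow_left₀ (abs_nonneg p) hp l)
    simp only [f, Real.norm_eq_abs]
    rw [abs_mul, abs_div, abs_pow]
    calc |p| ^ (l * (M + 1) + l.choose 2) / |qPochhammer p (l + M)| *
          |eulerSeries p (-p ^ (l + 1))|
        ≤ (1 / 4) ^ l / (1 / 2) ^ (l + M) * K := by gcongr
      _ = 2 ^ M * K * (1 / 2 : ℝ) ^ l := by
        rw [show (1 / 4 : ℝ) = 1 / 2 * (1 / 2) by norm_num, mul_pow, pow_add,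
          one_div_pow 2 M]
        field_simp
  have hlim : Tendsto (fun p => ∑' l, f p l) (𝓝 0) (𝓝 1) := by
    have h1 : ∑' l : ℕ, (0 : ℝ) ^ (l * (M + 1) + l.choose 2) * 1 = 1 := by
      rw [tsum_eq_single 0 fun n hn => by simp [hn]]
      simp
    rw [← h1]
    refine tendsto_tsum_of_dominated_convergence hbs (fun l => ?_)
      (eventually_abs_le_quarter.mono hbound)
    refine (?_ : Tendsto _ _ _).mul (tendsto_eulerSeries ?_)
    · simpa using tendsto_pow_div_qPochhammer (l * (M + 1) + l.choose 2) (l + M)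
    · have h : ContinuousAt (fun p : ℝ => -p ^ (l + 1)) 0 := by fun_prop
      simpa [ContinuousAt] using h
  have hE : Tendsto (fun p : ℝ => eulerSeries p p) (𝓝 0) (𝓝 1) := tendsto_eulerSeries tendsto_id
  have hneg : Tendsto (fun q : ℝ => -q) (𝓝[>] 0) (𝓝 0) := by
    have h : ContinuousAt (fun q : ℝ => -q) 0 := by fun_prop
    have h' := h.tendsto.mono_left (nhdsWithin_le_nhds (s := Set.Ioi 0))
    simpa using h'
  have hmain := (hlim.div hE one_ne_zero).comp hneg
  rw [div_one] at hmain
  refine hmain.congr' ?_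
  filter_upwards [hneg.eventually eventually_abs_le_quarter, self_mem_nhdsWithin,
    (hE.comp hneg).eventually_ne one_ne_zero] with q hq hq0 hEq
  have hq0 : 0 < q := hq0
  have := eulerSeries_mul_qAi hq (neg_ne_zero.2 hq0.ne') M
    (Summable.of_norm_bounded hbs (hbound _ hq))
  rw [neg_neg] at this
  simp only [Function.comp_apply, Pi.div_apply] at hEq ⊢
  rw [div_eq_div_iff hEq (by positivity), mul_comm, mul_comm (qAi _ _)]
  exact this.symm

/-- `q`-Bi is the dominant solution: `q`-Bi`(q^{-M}) ∼ 2 q^{-M(M-1)/2}` as `q → +0` for `M ≥ 1`,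
where the `2` comes from the two equal leading terms `n = M - 1` and `n = M` of the series. -/
lemma tendsto_qBi (M : ℕ) :
    Tendsto (fun q : ℝ => qBi q (-(M : ℤ)) * q ^ M.choose 2) (𝓝[>] 0)
      (𝓝 (if M = 0 then 1 else 2)) := by
  -- the power of `q` in the `n`-th term, after the leading power has been taken out
  let e : ℕ → ℕ := fun n => if M ≤ n then (n - M + 1).choose 2 else (M - n).choose 2
  have he : ∀ n, e n + M * n = (n + 1).choose 2 + M.choose 2 := by
    intro n
    have hz : ∀ a : ℕ, 2 * a.choose 2 + a = a * a := fun a => by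
      have := two_mul_choose_two a
      zify
      linarith
    have hch : ∀ a : ℕ, (a + 1).choose 2 = a + a.choose 2 := fun a => by
      rw [Nat.choose_succ_succ' a 1, Nat.choose_one_right]
    by_cases h : M ≤ n
    · obtain ⟨t, rfl⟩ := Nat.exists_eq_add_of_le h
      simp only [e, if_pos h, Nat.add_sub_cancel_left]
      have := hz M
      rw [hch, hch, choose_two_add]
      linarith
    · obtain ⟨t, rfl⟩ := Nat.exists_eq_add_of_le (not_le.1 h).le
      simp only [e, if_neg h, Nat.add_sub_cancel_left]
      have := hz n
      rw [hch, choose_two_add]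
      linarith
  let f : ℝ → ℕ → ℝ := fun q n => (-q) ^ e n / qSqFactorial q n
  have hbs : Summable fun n : ℕ => (1 / 4 : ℝ) ^ e n * 2 ^ n := by
    rw [← summable_nat_add_iff M]
    refine ((summable_quarter_pow_choose_mul_pow (1 / 2)).mul_left (2 ^ M)).congr fun n => ?_
    have : e (n + M) = n + n.choose 2 := by
      simp only [e, if_pos (Nat.le_add_left M n), Nat.add_sub_cancel]
      rw [Nat.choose_succ_succ' n 1, Nat.choose_one_right]
    rw [this, pow_add, pow_add, show (1 / 2 : ℝ) = 1 / 4 * 2 by norm_num, mul_pow]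
    ring
  have hlim : Tendsto (fun q => ∑' n, f q n) (𝓝 0) (𝓝 (if M = 0 then 1 else 2)) := by
    have h1 : ∑' n : ℕ, (0 : ℝ) ^ e n = if M = 0 then 1 else 2 := by
      have hne : ∀ n, n ≠ M → n + 1 ≠ M → (0 : ℝ) ^ e n = 0 := fun n h1 h2 => by
        refine zero_pow ?_
        simp only [e]
        split_ifs with h
        · exact (Nat.choose_pos (by omega)).ne'
        · exact (Nat.choose_pos (by omega)).ne'
      rcases M with _ | M
      · rw [tsum_eq_single 0 fun n hn => hne n hn (by omega)]
        simp [e]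
      · rw [tsum_eq_sum (s := {M, M + 1}) fun n hn => by
          simp only [Finset.mem_insert, Finset.mem_singleton, not_or] at hn
          exact hne n hn.2 (by omega), Finset.sum_pair (by omega)]
        simp [e]
        norm_num
    rw [← h1]
    refine tendsto_tsum_of_dominated_convergence hbs (fun n => ?_) ?_
    · have h : ContinuousAt (fun q : ℝ => (-q) ^ e n / qPochhammer (q ^ 2) n) 0 :=
        ContinuousAt.div (by fun_prop)
          ((continuous_qPochhammer n).comp (continuous_pow 2)).continuousAt
          (by simp [qPochhammer_zero_left])
      simpa [ContinuousAt, f, qPochhammer_zero_left, qSqFactorial_eq_qPochhammer] using h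
    · filter_upwards [eventually_abs_le_quarter] with q hq n
      have h2 := half_pow_le_abs_qPochhammer (abs_sq_le_quarter hq) n
      simp only [f, Real.norm_eq_abs]
      rw [qSqFactorial_eq_qPochhammer, abs_div, abs_pow, abs_neg]
      calc |q| ^ e n / |qPochhammer (q ^ 2) n| ≤ (1 / 4) ^ e n / (1 / 2) ^ n := by gcongr
        _ = (1 / 4) ^ e n * 2 ^ n := by rw [one_div_pow 2 n, div_div_eq_mul_div, div_one]
  refine (hlim.mono_left nhdsWithin_le_nhds).congr' ?_
  filter_upwards [self_mem_nhdsWithin] with q hq0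
  have hq0 : -q ≠ 0 := neg_ne_zero.2 (ne_of_gt hq0)
  have hsign : (-1 : ℝ) ^ (-(M : ℤ) * (-(M : ℤ) + 1) / 2) = (-1) ^ M.choose 2 := by
    rw [← zpow_natCast]
    congr 1
    rw [show -(M : ℤ) * (-(M : ℤ) + 1) = 2 * (M.choose 2 : ℕ) by rw [two_mul_choose_two]; ring]
    simp
  rw [qBi, hsign, mul_right_comm, ← neg_pow, ← tsum_mul_left]
  refine tsum_congr fun n => ?_
  simp only [f]
  rw [neg_pow_mul_eq, mul_succ_div_two_eq_choose, ← pow_mul, inv_pow]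
  have : (-q) ^ e n * (-q) ^ (M * n) = (-q) ^ (n + 1).choose 2 * (-q) ^ M.choose 2 := by
    rw [← pow_add, ← pow_add, he]
  rw [← mul_inv_cancel_right₀ (pow_ne_zero (M * n) hq0) ((-q) ^ e n), this]
  ring

/-! ### Leading terms -/

/-- The family `f(ε)` has the leading term `c e^{E/ε}`: `f(ε) = (c + o(1)) e^{E/ε}` as `ε → +0`.
The coefficient `c` may vanish, in which case this is only an upper bound. -/
def HasLeadingTerm (f : ℝ → ℝ) (c E : ℝ) : Prop :=
  Tendsto (fun ε : ℝ => f ε * Real.exp (-E / ε)) (𝓝[>] (0 : ℝ)) (𝓝 c)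

namespace HasLeadingTerm

lemma const (c : ℝ) : HasLeadingTerm (fun _ => c) c 0 := by
  simp [HasLeadingTerm]

lemma exp (E : ℝ) : HasLeadingTerm (fun ε => Real.exp (E / ε)) 1 E := by
  have : ∀ ε : ℝ, Real.exp (E / ε) * Real.exp (-E / ε) = 1 := fun ε => by
    rw [← Real.exp_add, neg_div, add_neg_cancel, Real.exp_zero]
  simp only [HasLeadingTerm, this]
  exact tendsto_const_nhds

lemma mul {f g : ℝ → ℝ} {c d E F : ℝ} (hf : HasLeadingTerm f c E) (hg : HasLeadingTerm g d F) :
    HasLeadingTerm (fun ε => f ε * g ε) (c * d) (E + F) := by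
  refine (Tendsto.mul hf hg).congr fun ε => ?_
  rw [neg_add, add_div, Real.exp_add]
  ring

lemma inv {f : ℝ → ℝ} {c E : ℝ} (hf : HasLeadingTerm f c E) (hc : c ≠ 0) :
    HasLeadingTerm (fun ε => (f ε)⁻¹) c⁻¹ (-E) := by
  refine (Tendsto.inv₀ hf hc).congr fun ε => ?_
  simp only [mul_inv, ← Real.exp_neg, neg_div]

lemma div {f g : ℝ → ℝ} {c d E F : ℝ} (hf : HasLeadingTerm f c E) (hg : HasLeadingTerm g d F)
    (hd : d ≠ 0) : HasLeadingTerm (fun ε => f ε / g ε) (c / d) (E - F) := by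
  simpa only [div_eq_mul_inv, sub_eq_add_neg] using hf.mul (hg.inv hd)

lemma exp_pow (E : ℝ) (n : ℕ) : HasLeadingTerm (fun ε => Real.exp (E / ε) ^ n) 1 (n * E) := by
  simpa only [← Real.exp_nat_mul, mul_div_assoc] using exp (n * E)

lemma prod {ι : Type*} (s : Finset ι) {f : ι → ℝ → ℝ} {c E : ι → ℝ}
    (h : ∀ i ∈ s, HasLeadingTerm (f i) (c i) (E i)) :
    HasLeadingTerm (fun ε => ∏ i ∈ s, f i ε) (∏ i ∈ s, c i) (∑ i ∈ s, E i) := by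
  classical
  induction s using Finset.induction_on with
  | empty => simpa using const 1
  | insert a s ha ih =>
    simp only [Finset.prod_insert ha, Finset.sum_insert ha]
    exact (h a (Finset.mem_insert_self a s)).mul
      (ih fun i hi => h i (Finset.mem_insert_of_mem hi))

lemma of_lt {f : ℝ → ℝ} {c E F : ℝ} (hf : HasLeadingTerm f c E) (h : E < F) :
    HasLeadingTerm f 0 F := by
  have h1 : Tendsto (fun ε : ℝ => Real.exp (-((F - E) * ε⁻¹))) (𝓝[>] 0) (𝓝 0) :=
    Real.tendsto_exp_neg_atTop_nhds_zero.comp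
      (tendsto_inv_nhdsGT_zero.const_mul_atTop (sub_pos.2 h))
  have h2 := Tendsto.mul hf h1
  rw [mul_zero] at h2
  refine h2.congr fun ε => ?_
  rw [mul_assoc, ← Real.exp_add]
  congr 2
  ring

lemma sum {ι : Type*} (s : Finset ι) {f : ι → ℝ → ℝ} {c : ι → ℝ} {E : ℝ}
    (h : ∀ i ∈ s, HasLeadingTerm (f i) (c i) E) :
    HasLeadingTerm (fun ε => ∑ i ∈ s, f i ε) (∑ i ∈ s, c i) E := by
  simpa only [HasLeadingTerm, Finset.sum_mul] using tendsto_finsetSum s h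

/-- A finite sum inherits exponent and sign of a term `t₀` that beats all others in the exponent,
except that one further term `t₁` may tie with it if its coefficient is smaller. -/
lemma sum_of_dominant {ι : Type*} [Fintype ι] {f : ι → ℝ → ℝ} {c E : ι → ℝ}
    (hf : ∀ t, HasLeadingTerm (f t) (c t) (E t)) (t₀ t₁ : ι) (h₀ : c t₀ ≠ 0)
    (h₁ : t₁ = t₀ ∨ E t₁ ≤ E t₀ ∧ |c t₁| < |c t₀|)
    (h : ∀ t, t ≠ t₀ → t ≠ t₁ → E t < E t₀) :
    ∃ C, 0 < C * c t₀ ∧ HasLeadingTerm (fun ε => ∑ t, f t ε) C (E t₀) := by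
  classical
  refine ⟨∑ t, if E t = E t₀ then c t else 0, ?_, sum _ fun t _ => ?_⟩
  · have hsq : 0 < c t₀ * c t₀ := mul_self_pos.2 h₀
    by_cases h10 : t₁ = t₀
    · rw [Fintype.sum_eq_single t₀ fun t ht => if_neg (h t ht (h10 ▸ ht)).ne, if_pos rfl]
      exact hsq
    · rw [Fintype.sum_eq_add t₀ t₁ (Ne.symm h10) fun t ht => if_neg (h t ht.1 ht.2).ne,
        if_pos rfl, add_mul]
      have hlt := (h₁.resolve_left h10).2
      split_ifs
      · have h3 : |c t₁ * c t₀| < c t₀ * c t₀ := by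
          rw [abs_mul, ← abs_mul_abs_self (c t₀)]
          exact mul_lt_mul_of_pos_right hlt (abs_pos.2 h₀)
        linarith [(abs_lt.1 h3).1]
      · simpa using hsq
  · split_ifs with hE
    · exact hE ▸ hf t
    · refine (hf t).of_lt (lt_of_le_of_ne ?_ hE)
      by_cases ht0 : t = t₀
      · exact (congrArg E ht0).le
      · by_cases ht1 : t = t₁
        · subst ht1
          exact (h₁.resolve_left ht0).1
        · exact (h t ht0 ht1).le

lemma hasPUltradiscreteLimit {f : ℝ → ℝ} {c E ζ : ℝ} (hf : HasLeadingTerm f c E)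
    (hζ : ζ = 1 ∨ ζ = -1) (hc : 0 < c * ζ) : HasPUltradiscreteLimit f ζ E := by
  have hc0 : c ≠ 0 := left_ne_zero_of_mul hc.ne'
  constructor
  · have hpos := (Tendsto.mul_const ζ hf).eventually_const_lt hc
    filter_upwards [hpos] with ε hε
    have h1 : 0 < f ε * ζ := by
      rw [mul_right_comm] at hε
      exact pos_of_mul_pos_left hε (Real.exp_pos _).le
    refine ⟨left_ne_zero_of_mul h1.ne', ?_⟩
    rcases hζ with rfl | rfl
    · rw [mul_one] at h1
      rw [abs_of_pos h1, div_self h1.ne']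
    · have h2 : f ε < 0 := by linarith
      rw [abs_of_neg h2, div_neg, div_self h2.ne]
  · have h1 : Tendsto (fun ε => Real.log |f ε * Real.exp (-E / ε)|) (𝓝[>] 0) (𝓝 (Real.log |c|)) :=
      ((Real.continuousAt_log (abs_ne_zero.2 hc0)).tendsto.comp hf.abs)
    have h2 : Tendsto (fun ε : ℝ => ε) (𝓝[>] 0) (𝓝 0) :=
      tendsto_id.mono_left nhdsWithin_le_nhds
    have h3 := (h2.mul h1).add_const E
    rw [zero_mul, zero_add] at h3
    refine h3.congr' ?_
    filter_upwards [self_mem_nhdsWithin, Tendsto.eventually_ne hf hc0] with ε hε hne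
    have hε : ε ≠ 0 := ne_of_gt hε
    rw [abs_mul, Real.abs_exp, Real.log_mul (abs_ne_zero.2 (left_ne_zero_of_mul hne))
      (Real.exp_pos _).ne', Real.log_exp]
    field_simp
    ring

end HasLeadingTerm

lemma tendsto_exp_div_nhdsGT {Q : ℝ} (hQ : Q < 0) :
    Tendsto (fun ε : ℝ => Real.exp (Q / ε)) (𝓝[>] 0) (𝓝[>] 0) := by
  refine tendsto_nhdsWithin_iff.2 ⟨?_, Eventually.of_forall fun ε => Real.exp_pos _⟩
  exact Real.tendsto_exp_atBot.comp (tendsto_inv_nhdsGT_zero.const_mul_atTop_of_neg hQ)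

lemma hasLeadingTerm_qAi {Q : ℝ} (hQ : Q < 0) {x : ℤ} (hx : x ≤ 0) :
    HasLeadingTerm (fun ε => qAi (Real.exp (Q / ε)) x) 1 (Q * ((x : ℝ) * (x - 1) / 2)) := by
  obtain ⟨M, rfl⟩ := (Int.eq_ofNat_of_zero_le (neg_nonneg.2 hx)).imp
    fun M h => neg_eq_iff_eq_neg.1 h
  have h := (tendsto_qAi M).comp (tendsto_exp_div_nhdsGT hQ)
  refine h.congr fun ε => ?_
  have h2 : (2 : ℝ) * ((M + 1).choose 2 : ℕ) = (M + 1) * M := by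
    exact_mod_cast (by simpa using two_mul_choose_two (M + 1) :
      2 * ((M + 1).choose 2 : ℤ) = (M + 1) * M)
  simp only [Function.comp_apply]
  rw [div_eq_mul_inv, ← Real.exp_nat_mul, ← Real.exp_neg]
  congr 2
  push_cast
  linear_combination (-Q / ε / 2) * h2

lemma hasLeadingTerm_qBi {Q : ℝ} (hQ : Q < 0) {x : ℤ} (hx : x ≤ 0) :
    HasLeadingTerm (fun ε => qBi (Real.exp (Q / ε)) x) (if x = 0 then 1 else 2)
      (-(Q * ((x : ℝ) * (x + 1) / 2))) := by
  obtain ⟨M, rfl⟩ := (Int.eq_ofNat_of_zero_le (neg_nonneg.2 hx)).imp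
    fun M h => neg_eq_iff_eq_neg.1 h
  have h := (tendsto_qBi M).comp (tendsto_exp_div_nhdsGT hQ)
  simp only [neg_eq_zero, Nat.cast_eq_zero]
  refine h.congr fun ε => ?_
  have h2 : (2 : ℝ) * (M.choose 2 : ℕ) = M * (M - 1) := by
    exact_mod_cast two_mul_choose_two M
  simp only [Function.comp_apply]
  rw [← Real.exp_nat_mul]
  congr 2
  push_cast
  linear_combination (Q / ε / 2) * h2

/-! ### The terms with maximal exponent in the Leibniz expansion -/

noncomputable section

/-- Exponent of the two summands of the seed at `τ = q^x`: the choice `true` stands for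
`c₂ q-Bi`, the choice `false` for `c₁ q-Ai`. -/
def seedExponent (Q A B : ℝ) (b : Bool) (x : ℤ) : ℝ :=
  if b then B - Q * ((x : ℝ) * (x + 1) / 2) else A + Q * ((x : ℝ) * (x - 1) / 2)

/-- Leading coefficient of the two summands of the seed at `τ = q^x`. -/
def seedCoeff (α β : ℝ) (b : Bool) (x : ℤ) : ℝ :=
  if b then β * (if x = 0 then 1 else 2) else α

/-- The two summands of the seed, as functions of `ε`. -/
def seedPart (Q A B α β : ℝ) (b : Bool) (x : ℤ) (ε : ℝ) : ℝ :=
  if b then β * Real.exp (B / ε) * qBi (Real.exp (Q / ε)) x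
  else α * Real.exp (A / ε) * qAi (Real.exp (Q / ε)) x

/-- Exponent of a term of the determinant. The term is given by a permutation `σ` (column `j`
uses row `σ j`) and by the choice `s j` of a summand of the seed in each column. -/
def termExponent (Q A B : ℝ) {n : ℕ} (m : ℤ) (t : Equiv.Perm (Fin n) × (Fin n → Bool)) : ℝ :=
  ∑ j, seedExponent Q A B (t.2 j) (m - (t.1 j : ℕ) + 2 * (j : ℕ))

/-- Leading coefficient of a term of the determinant. -/
def termCoeff (α β : ℝ) {n : ℕ} (m : ℤ) (t : Equiv.Perm (Fin n) × (Fin n → Bool)) : ℝ :=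
  (Equiv.Perm.sign t.1 : ℤ) * ∏ j, seedCoeff α β (t.2 j) (m - (t.1 j : ℕ) + 2 * (j : ℕ))

/-- The permutation that maps the first `k` columns to the last `k` rows in reversed order and
the other columns to the first rows in their order. -/
def blockPerm (n k : ℕ) : Equiv.Perm (Fin n) :=
  Equiv.ofBijective
    (fun j => ⟨if (j : ℕ) < k then n - 1 - j else j - k, by have := j.2; split_ifs <;> omega⟩)
    (Finite.injective_iff_bijective.1 fun i j h => by
      have hi := i.2
      have hj := j.2
      simp only [Fin.mk.injEq] at h
      ext
      split_ifs at h <;> omega)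

/-- The dominating term among those with `k` factors `q`-Bi. -/
def blockTerm (n k : ℕ) : Equiv.Perm (Fin n) × (Fin n → Bool) :=
  (blockPerm n k, fun j => decide ((j : ℕ) < k))

/-- Closed form of the exponent of `blockTerm (r + k) k`. -/
def blockExponent (Q A B r k m : ℝ) : ℝ :=
  r * A + k * B
    + Q * ((m + 2 * k + r) * (m + 2 * k + r - 1) * (m + 2 * k + r - 2) / 6
      - (m + 2 * k) * (m + 2 * k - 1) * (m + 2 * k - 2) / 6)
    - Q * (k * ((m - r - k + 1) ^ 2 + (m - r - k + 1)) + (6 * (m - r - k + 1) + 3) * k * (k - 1) / 2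
      + 3 / 2 * ((k - 1) * k * (2 * k - 1))) / 2

/-- The sign of `blockPerm n k`. -/
def blockSign (n k : ℕ) : ℝ :=
  ∏ i ∈ Finset.range k, (-1) ^ (n - 1 - i)

end

lemma blockPerm_val {n k : ℕ} (j : Fin n) :
    (blockPerm n k j : ℕ) = if (j : ℕ) < k then n - 1 - j else j - k := rfl

lemma blockPerm_lt_iff {n k : ℕ} {i j : Fin n} (h : i < j) :
    blockPerm n k i < blockPerm n k j ↔ k ≤ i := by
  rw [Fin.lt_def, blockPerm_val, blockPerm_val]
  have := Fin.lt_def.1 h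
  have := j.2
  split_ifs <;> omega

/-- A permutation is determined by its inversions. -/
lemma perm_eq_of_lt_iff {n : ℕ} {σ τ : Equiv.Perm (Fin n)}
    (h : ∀ i j, i < j → (σ i < σ j ↔ τ i < τ j)) : σ = τ := by
  have hmono : StrictMono (σ.symm.trans τ) := by
    intro a b hab
    have hab' : σ (σ.symm a) < σ (σ.symm b) := by simpa using hab
    rcases lt_trichotomy (σ.symm a) (σ.symm b) with h1 | h1 | h1
    · exact (h _ _ h1).1 hab'
    · rw [h1] at hab'
      exact absurd hab' (lt_irrefl _)
    · have h2 := mt (h _ _ h1).2 (not_lt.2 hab'.le)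
      exact lt_of_le_of_ne (not_lt.1 h2) fun h3 => h1.ne' (τ.injective h3)
  have h1 : hmono.orderIsoOfSurjective _ (σ.symm.trans τ).surjective = OrderIso.refl _ :=
    Subsingleton.elim _ _
  ext i
  have h2 := DFunLike.congr_fun h1 (σ i)
  simp only [StrictMono.coe_orderIsoOfSurjective, Equiv.trans_apply, Equiv.symm_apply_apply,
    OrderIso.refl_apply] at h2
  rw [h2]

lemma sum_lt_sum_of_pair {n : ℕ} {F G : Fin n → ℝ} {i j : Fin n} (hij : i ≠ j)
    (h : ∀ l, l ≠ i → l ≠ j → F l = G l) (hlt : F i + F j < G i + G j) :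
    ∑ l, F l < ∑ l, G l := by
  have : ∑ l, (G l - F l) = (G i - F i) + (G j - F j) :=
    Fintype.sum_eq_add i j hij fun l hl => by rw [h l hl.1 hl.2, sub_self]
  rw [Finset.sum_sub_distrib] at this
  linarith

section Exchange

variable {Q A B : ℝ} {n : ℕ} {m : ℤ}

/-- Exchanging the rows of the columns `i` and `j`, and possibly their choices too, changes two
summands of the exponent only. -/
lemma termExponent_lt_swap {σ : Equiv.Perm (Fin n)} {s s' : Fin n → Bool} {i j : Fin n}
    (hij : i ≠ j) (hs : ∀ l, l ≠ i → l ≠ j → s l = s' l)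
    (hlt : seedExponent Q A B (s i) (m - (σ i : ℕ) + 2 * (i : ℕ)) +
        seedExponent Q A B (s j) (m - (σ j : ℕ) + 2 * (j : ℕ)) <
      seedExponent Q A B (s' i) (m - (σ j : ℕ) + 2 * (i : ℕ)) +
        seedExponent Q A B (s' j) (m - (σ i : ℕ) + 2 * (j : ℕ))) :
    termExponent Q A B m (σ, s) < termExponent Q A B m (σ * Equiv.swap i j, s') := by
  refine sum_lt_sum_of_pair hij (fun l hi hj => ?_) ?_
  · simp only [Equiv.Perm.mul_apply]
    rw [Equiv.swap_apply_of_ne_of_ne hi hj, hs l hi hj]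
  · simpa only [Equiv.Perm.mul_apply, Equiv.swap_apply_left, Equiv.swap_apply_right] using hlt

/-- If all arguments `m - i + 2j` are nonpositive, then in a term with maximal exponent the
columns with the choice `q`-Bi come first, and a pair of columns is inverted exactly if the left
one has the choice `q`-Bi. In each other case, an exchange of two columns or two rows raises the
exponent: in the leading exponents the parts `± Q x²/2` count, and `x²` decreases when
`x = m - i + 2j ≤ 0` increases, that is to the right and upwards. -/
lemma pair_of_maximal (hQ : Q < 0) (hm : m + 2 * (n : ℤ) ≤ 2)
    {σ : Equiv.Perm (Fin n)} {s : Fin n → Bool}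
    (hmax : ∀ t : Equiv.Perm (Fin n) × (Fin n → Bool),
      termExponent Q A B m t ≤ termExponent Q A B m (σ, s)) {i j : Fin n} (hij : i < j) :
    ¬ (s i = false ∧ s j = true) ∧ (σ i < σ j ↔ s i = false) := by
  have hlt : ((i : ℕ) : ℝ) + 1 ≤ (j : ℕ) := by exact_mod_cast Fin.lt_def.1 hij
  have hjn : ((j : ℕ) : ℝ) + 1 ≤ n := by exact_mod_cast j.2
  have hm' : (m : ℝ) + 2 * n ≤ 2 := by exact_mod_cast hm
  have hσi : (0 : ℝ) ≤ (σ i : ℕ) := Nat.cast_nonneg _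
  have hσj : (0 : ℝ) ≤ (σ j : ℕ) := Nat.cast_nonneg _
  have hne : σ i ≠ σ j := fun h => hij.ne (σ.injective h)
  have hno : ¬ (s i = false ∧ s j = true) := by
    rintro ⟨h1, h2⟩
    refine absurd (hmax (σ * Equiv.swap i j, s ∘ Equiv.swap i j)) (not_le.2 ?_)
    refine termExponent_lt_swap hij.ne (fun l hi hj => ?_) ?_
    · simp [Equiv.swap_apply_of_ne_of_ne hi hj]
    · simp only [Function.comp_apply, Equiv.swap_apply_left, Equiv.swap_apply_right, h1, h2,
        seedExponent, if_true, Bool.false_eq_true, if_false]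
      push_cast
      generalize ((σ i : ℕ) : ℝ) = a at *
      generalize ((σ j : ℕ) : ℝ) = b at *
      generalize ((i : ℕ) : ℝ) = x at *
      generalize ((j : ℕ) : ℝ) = y at *
      have h3 : 0 < -Q * ((y - x) * (2 * (-(2 * m + 2 * x + 2 * y - a - b)))) :=
        mul_pos (by linarith) (mul_pos (by linarith) (by linarith))
      nlinarith
  refine ⟨hno, ?_⟩
  by_contra hcon
  -- in all remaining cases it is the rows that have to be exchanged
  refine absurd (hmax (σ * Equiv.swap i j, s)) (not_le.2 ?_)
  refine termExponent_lt_swap hij.ne (fun _ _ _ => rfl) ?_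
  have hcases : (s i = false ∧ s j = false ∧ ((σ j : ℕ) : ℝ) + 1 ≤ (σ i : ℕ)) ∨
      (s i = true ∧ ((σ i : ℕ) : ℝ) + 1 ≤ (σ j : ℕ)) := by
    rcases lt_or_gt_of_ne hne with h1 | h1
    · have h2 : s i = true := by
        simpa [h1] using hcon
      exact Or.inr ⟨h2, by exact_mod_cast Fin.lt_def.1 h1⟩
    · have h2 : s i = false := by
        by_contra h3
        exact hcon (by simp [h1.not_gt, h3])
      have h3 : s j = false := by
        by_contra h4
        exact hno ⟨h2, by simpa using h4⟩
      exact Or.inl ⟨h2, h3, by exact_mod_cast Fin.lt_def.1 h1⟩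
  simp only [seedExponent]
  push_cast
  generalize ((σ i : ℕ) : ℝ) = a at *
  generalize ((σ j : ℕ) : ℝ) = b at *
  generalize ((i : ℕ) : ℝ) = x at *
  generalize ((j : ℕ) : ℝ) = y at *
  rcases hcases with ⟨h1, h2, h3⟩ | ⟨h1, h3⟩
  · simp only [h1, h2, Bool.false_eq_true, if_false]
    have h4 : 0 < -Q * ((y - x) * (a - b)) :=
      mul_pos (by linarith) (mul_pos (by linarith) (by linarith))
    nlinarith
  · cases h2 : s j
    · simp only [h1, Bool.false_eq_true, if_true, if_false]
      have h4 : 0 < -Q * ((b - a) * (-(2 * m + 2 * x + 2 * y - a - b))) :=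
        mul_pos (by linarith) (mul_pos (by linarith) (by linarith))
      nlinarith
    · simp only [h1, if_true]
      have h4 : 0 < -Q * ((y - x) * (b - a)) :=
        mul_pos (by linarith) (mul_pos (by linarith) (by linarith))
      nlinarith

lemma exists_eq_blockTerm_of_maximal (hQ : Q < 0) (hm : m + 2 * (n : ℤ) ≤ 2)
    {t : Equiv.Perm (Fin n) × (Fin n → Bool)}
    (hmax : ∀ t' : Equiv.Perm (Fin n) × (Fin n → Bool),
      termExponent Q A B m t' ≤ termExponent Q A B m t) :
    ∃ k ≤ n, t = blockTerm n k := by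
  obtain ⟨σ, s⟩ := t
  have hpair := fun i j hij => pair_of_maximal (i := i) (j := j) hQ hm hmax hij
  have hs : ∃ k ≤ n, ∀ j : Fin n, s j = decide ((j : ℕ) < k) := by
    by_cases hall : ∃ j : ℕ, ∃ h : j < n, s ⟨j, h⟩ = false
    · classical
      refine ⟨Nat.find hall, (Nat.find_spec hall).1.le, fun j => ?_⟩
      obtain ⟨hk, hsk⟩ := Nat.find_spec hall
      by_cases hj : (j : ℕ) < Nat.find hall
      · have := Nat.find_min hall hj
        simp only [not_exists, Bool.not_eq_false] at this
        rw [decide_eq_true hj]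
        exact this j.2
      · rw [decide_eq_false hj]
        rcases eq_or_lt_of_le (not_lt.1 hj) with h | h
        · rw [← hsk]
          exact congrArg s (Fin.ext h.symm)
        · by_contra hne
          exact (hpair ⟨Nat.find hall, hk⟩ j (Fin.lt_def.2 h)).1 ⟨hsk, by simpa using hne⟩
    · push Not at hall
      exact ⟨n, le_rfl, fun j => by simpa using hall j j.2⟩
  obtain ⟨k, hk, hs⟩ := hs
  refine ⟨k, hk, Prod.ext (perm_eq_of_lt_iff fun i j hij => ?_) (funext hs)⟩
  rw [(hpair i j hij).2, hs, decide_eq_false_iff_not, not_lt]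
  exact (blockPerm_lt_iff hij).symm

lemma eq_blockTerm_or_lt (hQ : Q < 0) (hm : m + 2 * (n : ℤ) ≤ 2)
    (t : Equiv.Perm (Fin n) × (Fin n → Bool)) :
    (∃ k ≤ n, t = blockTerm n k) ∨
      ∃ k ≤ n, termExponent Q A B m t < termExponent Q A B m (blockTerm n k) := by
  obtain ⟨t', ht'⟩ := Finite.exists_max (termExponent (n := n) Q A B m)
  obtain ⟨k, hk, rfl⟩ := exists_eq_blockTerm_of_maximal hQ hm ht'
  rcases (ht' t).lt_or_eq with h | h
  · exact Or.inr ⟨k, hk, h⟩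
  · exact Or.inl (exists_eq_blockTerm_of_maximal hQ hm fun t'' => h ▸ ht' t'')

end Exchange

lemma sum_range_mul_succ_div_two (y : ℝ) (k : ℕ) :
    ∑ i ∈ Finset.range k, (y + 3 * i) * (y + 3 * i + 1) / 2 =
      (k * (y ^ 2 + y) + (6 * y + 3) * k * (k - 1) / 2
        + 3 / 2 * ((k - 1) * k * (2 * k - 1))) / 2 := by
  induction k with
  | zero => simp
  | succ k ih =>
    rw [Finset.sum_range_succ, ih]
    push_cast
    ring

lemma sum_range_mul_pred_div_two (u : ℝ) (r : ℕ) :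
    ∑ i ∈ Finset.range r, (u + i) * (u + i - 1) / 2 =
      (u + r) * (u + r - 1) * (u + r - 2) / 6 - u * (u - 1) * (u - 2) / 6 := by
  induction r with
  | zero => simp
  | succ r ih =>
    rw [Finset.sum_range_succ, ih]
    push_cast
    ring

lemma termExponent_blockTerm (Q A B : ℝ) (r k : ℕ) (m : ℤ) :
    termExponent Q A B m (blockTerm (r + k) k) = blockExponent Q A B r k m := by
  have h1 : ∀ j : Fin (r + k), seedExponent Q A B ((blockTerm (r + k) k).2 j)
      (m - ((blockTerm (r + k) k).1 j : ℕ) + 2 * (j : ℕ)) =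
      (fun j : ℕ => if j < k then
          B - Q * (((m - r - k + 1 : ℝ) + 3 * j) * ((m - r - k + 1 : ℝ) + 3 * j + 1) / 2)
        else A + Q * ((m + j + k : ℝ) * (m + j + k - 1) / 2)) (j : ℕ) := by
    intro j
    have hj := j.2
    simp only [blockTerm, blockPerm_val, seedExponent, decide_eq_true_eq]
    split_ifs with h
    · push_cast [Nat.cast_sub (show (j : ℕ) ≤ r + k - 1 by omega),
        Nat.cast_sub (show 1 ≤ r + k by omega)]
      ring
    · push_cast [Nat.cast_sub (not_lt.1 h)]
      ring
  rw [termExponent, Finset.sum_congr rfl fun j _ => h1 j,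
    Fin.sum_univ_eq_sum_range (fun j : ℕ => if j < k then
          B - Q * (((m - r - k + 1 : ℝ) + 3 * j) * ((m - r - k + 1 : ℝ) + 3 * j + 1) / 2)
        else A + Q * ((m + j + k : ℝ) * (m + j + k - 1) / 2)) (r + k), add_comm r k,
    Finset.sum_range_add,
    Finset.sum_congr rfl fun j hj => if_pos (Finset.mem_range.1 hj)]
  have h2 : ∀ i ∈ Finset.range r, (if k + i < k then
        B - Q * (((m - r - k + 1 : ℝ) + 3 * (k + i : ℕ)) *
          ((m - r - k + 1 : ℝ) + 3 * (k + i : ℕ) + 1) / 2)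
      else A + Q * ((m + (k + i : ℕ) + k : ℝ) * (m + (k + i : ℕ) + k - 1) / 2)) =
      A + Q * (((m + 2 * k : ℝ) + i) * ((m + 2 * k : ℝ) + i - 1) / 2) := fun i _ => by
    rw [if_neg (by omega)]
    push_cast
    ring
  rw [Finset.sum_congr rfl h2, Finset.sum_sub_distrib, Finset.sum_add_distrib, ← Finset.mul_sum,
    ← Finset.mul_sum, sum_range_mul_succ_div_two, sum_range_mul_pred_div_two, blockExponent]
  simp
  ring

lemma sign_blockPerm {n k : ℕ} (hk : k ≤ n) :
    ((Equiv.Perm.sign (blockPerm n k) : ℤ) : ℝ) = blockSign n k := by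
  have h1 : ∀ i : Fin n, (∏ j ∈ Finset.Ioi i,
      (if blockPerm n k i < blockPerm n k j then 1 else -1 : ℤˣ)) =
      (fun i : ℕ => if i < k then (-1 : ℤˣ) ^ (n - 1 - i) else 1) (i : ℕ) := fun i => by
    rw [Finset.prod_congr rfl fun j hj =>
      if_congr (blockPerm_lt_iff (Finset.mem_Ioi.1 hj)) rfl rfl, Finset.prod_const, Fin.card_Ioi]
    by_cases h : (i : ℕ) < k
    · simp [h]
    · simp [h, not_lt.1 h]
  obtain ⟨r, rfl⟩ := Nat.exists_eq_add_of_le hk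
  rw [Equiv.Perm.sign_eq_prod_prod_Ioi, Finset.prod_congr rfl fun i _ => h1 i,
    Fin.prod_univ_eq_prod_range (fun i : ℕ => if i < k then (-1 : ℤˣ) ^ (k + r - 1 - i) else 1),
    Finset.prod_range_add, Finset.prod_congr rfl fun j hj => if_pos (Finset.mem_range.1 hj),
    Finset.prod_congr rfl (s₁ := Finset.range r) fun j _ =>
      if_neg (Nat.not_lt.2 (k.le_add_right j)),
    Finset.prod_const_one, mul_one, blockSign]
  push_cast
  rfl

lemma termCoeff_blockTerm (α β : ℝ) {r k : ℕ} {m : ℤ}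
    (h : 0 < k → m + 2 * k < r + 2) :
    termCoeff α β m (blockTerm (r + k) k) =
      blockSign (r + k) k * (α ^ r * (2 * β) ^ k) := by
  have h1 : ∀ j : Fin (r + k), seedCoeff α β ((blockTerm (r + k) k).2 j)
      (m - ((blockTerm (r + k) k).1 j : ℕ) + 2 * (j : ℕ)) =
      (fun j : ℕ => if j < k then 2 * β else α) (j : ℕ) := by
    intro j
    have hj := j.2
    by_cases hjk : (j : ℕ) < k
    · have hx : m - ((blockTerm (r + k) k).1 j : ℕ) + 2 * (j : ℕ) ≠ 0 := by
        have hval : ((blockTerm (r + k) k).1 j : ℕ) = r + k - 1 - j := by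
          simp [blockTerm, blockPerm_val, hjk]
        rw [hval]
        omega
      have hb : (blockTerm (r + k) k).2 j = true := decide_eq_true hjk
      simp only [seedCoeff, if_neg hx, if_pos hb, if_pos hjk]
      exact mul_comm _ _
    · simp [seedCoeff, blockTerm, hjk]
  have hsign : ((Equiv.Perm.sign (blockTerm (r + k) k).1 : ℤ) : ℝ) = blockSign (r + k) k :=
    sign_blockPerm (Nat.le_add_left k r)
  rw [termCoeff, hsign, Finset.prod_congr rfl fun j _ => h1 j,
    Fin.prod_univ_eq_prod_range (fun j : ℕ => if j < k then 2 * β else α), add_comm r k,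
    Finset.prod_range_add, Finset.prod_congr rfl fun j hj => if_pos (Finset.mem_range.1 hj),
    Finset.prod_congr rfl (s₁ := Finset.range r) fun j _ =>
      if_neg (Nat.not_lt.2 (k.le_add_right j)),
    Finset.prod_const, Finset.prod_const, Finset.card_range, Finset.card_range,
    mul_comm (α ^ r)]

/-! ### The leading term of the determinant -/

lemma hasLeadingTerm_seedPart {Q : ℝ} (hQ : Q < 0) (A B α β : ℝ) (b : Bool) {x : ℤ} (hx : x ≤ 0) :
    HasLeadingTerm (seedPart Q A B α β b x) (seedCoeff α β b x) (seedExponent Q A B b x) := by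
  cases b
  · have h := ((HasLeadingTerm.const α).mul (HasLeadingTerm.exp A)).mul (hasLeadingTerm_qAi hQ hx)
    rw [mul_one, mul_one, zero_add] at h
    exact h
  · have h := ((HasLeadingTerm.const β).mul (HasLeadingTerm.exp B)).mul (hasLeadingTerm_qBi hQ hx)
    rw [mul_one, zero_add, ← sub_eq_add_neg] at h
    exact h

/-- The Leibniz expansion of the determinant, with both summands of the seed multiplied out. -/
lemma airyDet_eq_sum (Q A B α β ε : ℝ) (n : ℕ) (m : ℤ) :
    airyDet (airySeed (Real.exp (Q / ε)) (α * Real.exp (A / ε)) (β * Real.exp (B / ε))) n m =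
      ∑ t : Equiv.Perm (Fin n) × (Fin n → Bool), (Equiv.Perm.sign t.1 : ℤ) *
        ∏ j, seedPart Q A B α β (t.2 j) (m - (t.1 j : ℕ) + 2 * (j : ℕ)) ε := by
  have hseed : ∀ x, airySeed (Real.exp (Q / ε)) (α * Real.exp (A / ε)) (β * Real.exp (B / ε)) x =
      ∑ b, seedPart Q A B α β b x ε := fun x => by
    rw [Fintype.sum_bool, add_comm]
    rfl
  simp only [airyDet, Matrix.det_apply', Matrix.of_apply, hseed, Fintype.prod_sum, Finset.mul_sum,
    Fintype.sum_prod_type]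

lemma hasLeadingTerm_term {Q : ℝ} (hQ : Q < 0) (A B α β : ℝ) {n : ℕ} {m : ℤ}
    (hm : m + 2 * (n : ℤ) ≤ 2) (t : Equiv.Perm (Fin n) × (Fin n → Bool)) :
    HasLeadingTerm (fun ε => (Equiv.Perm.sign t.1 : ℤ) *
        ∏ j, seedPart Q A B α β (t.2 j) (m - (t.1 j : ℕ) + 2 * (j : ℕ)) ε)
      (termCoeff α β m t) (termExponent Q A B m t) := by
  have h := (HasLeadingTerm.const ((Equiv.Perm.sign t.1 : ℤ) : ℝ)).mul
    (HasLeadingTerm.prod Finset.univ fun j _ =>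
      hasLeadingTerm_seedPart hQ A B α β (t.2 j) (x := m - (t.1 j : ℕ) + 2 * (j : ℕ)) (by
        have := j.2
        omega))
  rw [zero_add] at h
  exact h

/-- A strictly concave finite sequence with `e (k - 1) ≤ e k` and `e (k + 1) < e k` is smaller than
`e k` everywhere except possibly at `k - 1`. -/
lemma lt_of_concave {e : ℕ → ℝ} {n k : ℕ}
    (hconc : ∀ i, i + 2 ≤ n → e (i + 2) - e (i + 1) < e (i + 1) - e i)
    (hleft : ∀ l, l + 1 = k → e l ≤ e k) (hright : k < n → e (k + 1) < e k) (hk : k ≤ n)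
    {i : ℕ} (hi : i ≤ n) (hik : i ≠ k) (hik' : i + 1 ≠ k) : e i < e k := by
  have hmono : ∀ a d, a + d + 2 ≤ n → e (a + d + 2) - e (a + d + 1) < e (a + 1) - e a := by
    intro a d
    induction d with
    | zero => exact hconc a
    | succ d ih => exact fun h => (hconc (a + d + 1) h).trans (ih (by omega))
  rcases lt_or_gt_of_ne hik with h | h
  · obtain ⟨l, rfl⟩ : ∃ l, k = l + 1 := ⟨k - 1, by omega⟩
    have hl := hleft l rfl
    have hstep : ∀ a, a < l → e a < e (a + 1) := fun a ha => by
      obtain ⟨d, rfl⟩ := Nat.exists_eq_add_of_lt ha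
      have := hmono a d hk
      linarith
    have hle : ∀ d, i + d + 1 ≤ l → e i < e (i + d + 1) := by
      intro d
      induction d with
      | zero => exact fun hd => hstep i hd
      | succ d ih => exact fun hd => (ih (by omega)).trans (hstep _ hd)
    obtain ⟨d, rfl⟩ := Nat.exists_eq_add_of_lt (show i < l by omega)
    exact (hle d le_rfl).trans_le hl
  · have hstep : ∀ d, k + d + 1 ≤ n → e (k + d + 1) < e k := by
      intro d
      induction d with
      | zero => exact fun hd => hright hd
      | succ d ih =>
        intro hd
        have h1 := hmono k d hd
        have h2 := ih (by omega)
        have h3 := hright (by omega)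
        rw [show k + (d + 1) + 1 = k + d + 2 by ring]
        linarith
    obtain ⟨d, rfl⟩ := Nat.exists_eq_add_of_lt h
    exact hstep d hi

/-- Among the terms `blockTerm (r + k) i`, the one with `i = k` dominates, where a tie in the
exponent is allowed with `i = k - 1` only. The condition `m + 2 * k < r + 2` says that the
arguments of the factors `q`-Bi of this term are negative, so that each brings a factor `2`. -/
def BlockDominates (Q A B : ℝ) (r k : ℕ) (m : ℤ) : Prop :=
  (0 < k → m + 2 * k < r + 2 ∧
    Q * (((m : ℝ) + 2 * k - 2 - r) ^ 2 - r * (r + 1)) ≤ B - A) ∧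
  (0 < r → B - A < Q * (((m : ℝ) + 2 * k + 1 - r) ^ 2 - (r - 1) * r))

lemma abs_eq_one {x : ℝ} (h : x = 1 ∨ x = -1) : |x| = 1 := by
  rcases h with rfl | rfl <;> simp

lemma abs_blockSign (n k : ℕ) : |blockSign n k| = 1 := by
  rw [blockSign, Finset.abs_prod]
  exact Finset.prod_eq_one fun i _ => by rw [abs_pow, abs_neg, abs_one, one_pow]

/-- The leading term of the determinant comes from the dominating `blockTerm`. In a tie with the
preceding one the latter has half the absolute value, so that no cancellation occurs. -/
lemma exists_hasLeadingTerm_airyDet {Q A B α β : ℝ} (hQ : Q < 0) (hα : α = 1 ∨ α = -1)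
    (hβ : β = 1 ∨ β = -1) {r k : ℕ} {m : ℤ} (hm : m + 2 * ((r + k : ℕ) : ℤ) ≤ 2)
    (h : BlockDominates Q A B r k m) :
    ∃ C, 0 < C * (blockSign (r + k) k * (α ^ r * β ^ k)) ∧
      HasLeadingTerm (fun ε => airyDet (airySeed (Real.exp (Q / ε)) (α * Real.exp (A / ε))
        (β * Real.exp (B / ε))) (r + k) m) C (blockExponent Q A B r k m) := by
  set n := r + k with hn
  have hα' := abs_eq_one hα
  have hβ' := abs_eq_one hβ
  have hexp : ∀ i ≤ n, termExponent Q A B m (blockTerm n i) =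
      blockExponent Q A B ((n : ℝ) - i) i m := fun i hi => by
    obtain ⟨r', hr'⟩ := Nat.exists_eq_add_of_le' hi
    rw [hr', termExponent_blockTerm]
    push_cast
    ring_nf
  have hdiff : ∀ i : ℝ, blockExponent Q A B (n - (i + 1)) (i + 1) m -
      blockExponent Q A B (n - i) i m =
      B - A - Q * ((m + 3 * i + 1 - n) ^ 2 - (n - i) * (n - i - 1)) := fun i => by
    simp only [blockExponent]
    ring
  have hnr : (n : ℝ) = r + k := by rw [hn]; push_cast; ring
  have hle : ∀ l, l + 1 = k →
      blockExponent Q A B (n - l) l m ≤ blockExponent Q A B (n - k) k m := by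
    intro l hl
    have h1 := hdiff l
    have h2 := (h.1 (by omega)).2
    have hk : (k : ℝ) = l + 1 := by rw [← hl]; push_cast; ring
    simp only [hk] at h2 ⊢
    rw [show (m : ℝ) + 3 * l + 1 - n = m + 2 * (l + 1) - 2 - r by rw [hnr, hk]; ring,
      show (n : ℝ) - l = r + 1 by rw [hnr, hk]; ring] at h1
    rw [show (n : ℝ) - l = r + 1 by rw [hnr, hk]; ring]
    nlinarith
  have hlt : ∀ i ≤ n, i ≠ k → i + 1 ≠ k →
      termExponent Q A B m (blockTerm n i) < termExponent Q A B m (blockTerm n k) := by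
    intro i hi hik hik'
    rw [hexp i hi, hexp k (Nat.le_add_left k r)]
    refine lt_of_concave (e := fun i : ℕ => blockExponent Q A B ((n : ℝ) - i) i m) (n := n)
      (fun i hi => ?_) hle (fun hkn => ?_) (Nat.le_add_left k r) hi hik hik'
    · have h1 := hdiff i
      have h2 := hdiff (i + 1)
      have hm' : (m : ℝ) + 2 * n ≤ 2 := by exact_mod_cast hm
      have hi' : (i : ℝ) + 2 ≤ n := by exact_mod_cast hi
      push_cast
      rw [show (i : ℝ) + 2 = i + 1 + 1 by ring, h1, h2]
      have : 0 < -Q * (-(6 * (m + 3 * i + 1 - n) + 9 + 2 * (n - i - 1))) :=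
        mul_pos (by linarith) (by linarith)
      nlinarith
    · have h1 := hdiff k
      have h2 := h.2 (by omega)
      rw [show (m : ℝ) + 3 * k + 1 - n = m + 2 * k + 1 - r by rw [hnr]; ring,
        show (n : ℝ) - k = r by rw [hnr]; ring] at h1
      push_cast
      rw [show (n : ℝ) - k = r by rw [hnr]; ring]
      nlinarith
  have hck : termCoeff α β m (blockTerm n k) = blockSign n k * (α ^ r * (2 * β) ^ k) :=
    termCoeff_blockTerm α β fun hk => (h.1 hk).1
  have habs : |termCoeff α β m (blockTerm n k)| = 2 ^ k := by
    rw [hck, abs_mul, abs_mul, abs_pow, abs_pow, abs_mul, abs_blockSign, hα', hβ']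
    simp
  obtain ⟨C, hC, hlead⟩ := HasLeadingTerm.sum_of_dominant
    (hasLeadingTerm_term hQ A B α β hm) (blockTerm n k) (blockTerm n (k - 1))
    (by rw [← abs_pos, habs]; positivity)
    (by
      rcases k with _ | l
      · exact Or.inl rfl
      · refine Or.inr ⟨?_, ?_⟩
        · rw [hexp _ (by omega), hexp _ (by omega)]
          exact hle l rfl
        · rw [habs, Nat.add_sub_cancel, show n = r + 1 + l by omega, termCoeff_blockTerm α β
            (fun _ => by have := (h.1 (by omega)).1; push_cast at this ⊢; omega), abs_mul,
            abs_mul, abs_pow, abs_pow, abs_mul, abs_blockSign, hα', hβ']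
          simp only [one_pow, mul_one, one_mul, Nat.abs_ofNat]
          exact pow_lt_pow_right₀ one_lt_two l.lt_succ_self)
    (fun t h0 h1 => by
      rcases eq_blockTerm_or_lt hQ hm t with ⟨i, hi, rfl⟩ | ⟨i, hi, hlt'⟩
      · exact hlt i hi (fun h => h0 (by rw [h])) (fun h => h1 (by rw [← h, Nat.add_sub_cancel]))
      · refine hlt'.trans_le ?_
        by_cases hik : i = k
        · rw [hik]
        by_cases hik' : i + 1 = k
        · rw [hexp _ hi, hexp _ (Nat.le_add_left k r)]
          exact hle i hik'
        · exact (hlt i hi hik hik').le)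
  refine ⟨C, ?_, ?_⟩
  · rw [hck, mul_pow, show C * (blockSign n k * (α ^ r * (2 ^ k * β ^ k))) =
      C * (blockSign n k * (α ^ r * β ^ k)) * 2 ^ k by ring] at hC
    exact pos_of_mul_pos_left hC (by positivity)
  · rw [termExponent_blockTerm] at hlead
    simpa only [airyDet_eq_sum] using hlead

/-! ### Signs, thresholds and the p-ultradiscrete limit -/

noncomputable section

/-- The part of the sign of the dominating term of the determinant that depends on the number
`r` of its factors `q`-Ai; the rest depends on the size of the determinant only. -/
def airySign (α β : ℝ) (r : ℕ) : ℝ :=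
  (α * β) ^ r * (-1) ^ r.choose 2

end

lemma airySign_succ (α β : ℝ) (r : ℕ) :
    airySign α β (r + 1) = airySign α β r * (α * β * (-1) ^ r) := by
  rw [airySign, airySign, Nat.choose_succ_succ' r 1, Nat.choose_one_right, pow_add, pow_succ]
  ring

lemma blockSign_add_one (r k : ℕ) :
    blockSign (r + (k + 1)) (k + 1) = (-1) ^ (r + k) * blockSign (r + k) k := by
  rw [blockSign, Finset.prod_range_succ', mul_comm, blockSign]
  congr 1
  refine Finset.prod_congr rfl fun i _ => ?_
  congr 1
  omega

lemma mul_self_neg_one_pow (n : ℕ) : (-1 : ℝ) ^ n * (-1) ^ n = 1 := by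
  rw [← mul_pow]
  simp

lemma blockSign_eq (r k : ℕ) :
    blockSign (r + k) k = (-1) ^ (r + k).choose 2 * (-1) ^ r.choose 2 := by
  induction k with
  | zero => rw [add_zero, mul_self_neg_one_pow]; simp [blockSign]
  | succ k ih =>
    rw [blockSign_add_one, ih, ← add_assoc, Nat.choose_succ_succ' (r + k) 1,
      Nat.choose_one_right, pow_add]
    ring

lemma mul_self_eq_one {x : ℝ} (h : x = 1 ∨ x = -1) : x * x = 1 := by
  rcases h with rfl | rfl <;> norm_num

lemma airySign_mul_self {α β : ℝ} (hα : α = 1 ∨ α = -1) (hβ : β = 1 ∨ β = -1) (r : ℕ) :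
    airySign α β r * airySign α β r = 1 := by
  rw [airySign, mul_mul_mul_comm, mul_self_neg_one_pow, ← mul_pow, mul_mul_mul_comm,
    mul_self_eq_one hα, mul_self_eq_one hβ]
  simp

lemma blockSign_mul_eq {α β : ℝ} (hβ : β = 1 ∨ β = -1) (r k : ℕ) :
    blockSign (r + k) k * (α ^ r * β ^ k) =
      (-1) ^ (r + k).choose 2 * β ^ (r + k) * airySign α β r := by
  have : β ^ r * β ^ r = 1 := by rw [← mul_pow, mul_self_eq_one hβ, one_pow]
  rw [blockSign_eq, airySign, pow_add β, mul_pow]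
  linear_combination (-(-1) ^ (r + k).choose 2 * (-1) ^ r.choose 2 * α ^ r * β ^ k) * this

/-- The p-ultradiscrete limit of `z^{(N)}(m)`, in terms of the numbers `r₁, …, r₄` of factors
`q`-Ai in the dominating terms of its four determinants. -/
lemma hasPUltradiscreteLimit_detSolutionEps {Q A B α β : ℝ} (hQ : Q < 0) (hα : α = 1 ∨ α = -1)
    (hβ : β = 1 ∨ β = -1) {N : ℕ} {m : ℤ} (hm : m ≤ -2 * N - 1) (r₁ r₂ r₃ r₄ : ℕ)
    {k₁ k₂ k₃ k₄ : ℕ} (h₁ : r₁ + k₁ = N) (h₂ : r₂ + k₂ = N + 1) (h₃ : r₃ + k₃ = N)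
    (h₄ : r₄ + k₄ = N + 1) (d₁ : BlockDominates Q A B r₁ k₁ m)
    (d₂ : BlockDominates Q A B r₂ k₂ (m + 1)) (d₃ : BlockDominates Q A B r₃ k₃ (m + 1))
    (d₄ : BlockDominates Q A B r₄ k₄ m) {ζ Z : ℝ}
    (hζ : airySign α β r₁ * airySign α β r₂ * (airySign α β r₃ * airySign α β r₄) = ζ)
    (hZ : blockExponent Q A B r₁ k₁ m + blockExponent Q A B r₂ k₂ (m + 1) -
      (N * Q + blockExponent Q A B r₃ k₃ (m + 1) + blockExponent Q A B r₄ k₄ m) = Z) :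
    HasPUltradiscreteLimit (detSolutionEps Q A B α β N m) ζ Z := by
  obtain ⟨C₁, hC₁, l₁⟩ := exists_hasLeadingTerm_airyDet hQ hα hβ (by omega) d₁
  obtain ⟨C₂, hC₂, l₂⟩ := exists_hasLeadingTerm_airyDet hQ hα hβ (by omega) d₂
  obtain ⟨C₃, hC₃, l₃⟩ := exists_hasLeadingTerm_airyDet hQ hα hβ (by omega) d₃
  obtain ⟨C₄, hC₄, l₄⟩ := exists_hasLeadingTerm_airyDet hQ hα hβ (by omega) d₄
  rw [blockSign_mul_eq hβ] at hC₁ hC₂ hC₃ hC₄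
  rw [h₁] at hC₁ l₁
  rw [h₂] at hC₂ l₂
  rw [h₃] at hC₃ l₃
  rw [h₄] at hC₄ l₄
  have hc₃ : C₃ ≠ 0 := left_ne_zero_of_mul hC₃.ne'
  have hc₄ : C₄ ≠ 0 := left_ne_zero_of_mul hC₄.ne'
  have hlead := (l₁.mul l₂).div (((HasLeadingTerm.exp_pow Q N).mul l₃).mul l₄)
    (mul_ne_zero (mul_ne_zero one_ne_zero hc₃) hc₄)
  push_cast at hlead
  rw [hZ] at hlead
  have hs := airySign_mul_self hα hβ
  have hβs : ∀ n : ℕ, β ^ n * β ^ n = 1 := fun n => by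
    rw [← mul_pow, mul_self_eq_one hβ, one_pow]
  refine HasLeadingTerm.hasPUltradiscreteLimit hlead ?_ ?_
  · rw [← mul_self_eq_one_iff, ← hζ]
    linear_combination airySign α β r₂ ^ 2 * airySign α β r₃ ^ 2 *
      airySign α β r₄ ^ 2 * hs r₁ + airySign α β r₃ ^ 2 * airySign α β r₄ ^ 2 * hs r₂ +
      airySign α β r₄ ^ 2 * hs r₃ + hs r₄
  · have hpos := mul_pos (mul_pos hC₁ hC₂) (mul_pos hC₃ hC₄)
    have heq : ∀ a b x y : ℝ, a * a = 1 → b * b = 1 → x * x = 1 → y * y = 1 →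
        C₁ * (a * x * airySign α β r₁) * (C₂ * (b * y * airySign α β r₂)) *
          (C₃ * (a * x * airySign α β r₃) * (C₄ * (b * y * airySign α β r₄))) =
        C₁ * C₂ * (C₃ * C₄) * ζ := fun a b x y ha hb hx hy => by
      rw [← hζ]
      calc _ = C₁ * C₂ * (C₃ * C₄) * (airySign α β r₁ * airySign α β r₂ *
            (airySign α β r₃ * airySign α β r₄)) * ((a * a) * (b * b) * ((x * x) * (y * y))) := by
            ring
        _ = _ := by rw [ha, hb, hx, hy]; ring
    rw [heq _ _ _ _ (mul_self_neg_one_pow _) (mul_self_neg_one_pow _) (hβs _) (hβs _)] at hpos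
    rw [show C₁ * C₂ / (1 * C₃ * C₄) * ζ = C₁ * C₂ * (C₃ * C₄) * ζ / (C₃ * C₄) ^ 2 by
      field_simp]
    positivity

/-- The dominating term in terms of the integers `m₀` and `k₀` that locate `B - A` between the
thresholds: its rightmost argument `y = m + 2k - 2 - r` of `q`-Bi satisfies `y < m₀`, or `y = m₀`
and `r ≤ N - k₀`, whereas the argument `y + 3` that one more factor `q`-Bi would bring does not
satisfy the same condition with `r - 1` instead of `r`. -/
lemma blockDominates_of_thresholds {Q A B : ℝ} (hQ : Q < 0) {N : ℕ} {m₀ : ℤ}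
    (hm₀ : m₀ ≤ min (-3 * (N : ℤ) - 2) (-((N : ℤ) * ((N : ℤ) + 1) / 2) - 1))
    (hm₀_le : (m₀ : ℝ) ^ 2 * Q ≤ B - A) (hm₀_lt : B - A < ((m₀ : ℝ) + 1) ^ 2 * Q)
    {k₀ : ℕ} (hk₀ : k₀ ≤ N)
    (hk₀_le : thresholdP Q N m₀ (k₀ + 1) ≤ B - A) (hk₀_lt : B - A < thresholdP Q N m₀ k₀)
    {r k : ℕ} {m : ℤ} (hrk : r + k ≤ N + 1) (hm : m + 2 * (r + k) ≤ 2)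
    (hb : 0 < k → m + 2 * k - 2 - r < m₀ ∨ m + 2 * k - 2 - r = m₀ ∧ r + k₀ ≤ N)
    (ha : 0 < r → m₀ < m + 2 * k + 1 - r ∨ m + 2 * k + 1 - r = m₀ ∧ N + 2 ≤ r + k₀) :
    BlockDominates Q A B r k m := by
  have hm₁ : 2 * m₀ ≤ -((N : ℤ) * ((N : ℤ) + 1)) - 1 := by
    have := hm₀.trans (min_le_right _ _)
    generalize (N : ℤ) * ((N : ℤ) + 1) = X at *
    omega
  have hm₂ : m₀ ≤ -3 * (N : ℤ) - 2 := hm₀.trans (min_le_left _ _)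
  have hr0 : (0 : ℤ) ≤ r := Int.natCast_nonneg r
  refine ⟨fun hk => ⟨?_, ?_⟩, fun hr => ?_⟩
  · have := hb hk
    omega
  · rcases hb hk with hy | ⟨hy, hr⟩
    · refine le_trans ?_ hm₀_le
      have hrN : (r : ℤ) ≤ N := by omega
      have key : m₀ ^ 2 ≤ (m + 2 * k - 2 - r) ^ 2 - (r : ℤ) * (r + 1) := by nlinarith
      have key' : (m₀ : ℝ) ^ 2 ≤ ((m : ℝ) + 2 * k - 2 - r) ^ 2 - r * (r + 1) := by
        exact_mod_cast key
      nlinarith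
    · refine le_trans ?_ hk₀_le
      have hr' : (r : ℝ) + k₀ ≤ N := by exact_mod_cast hr
      have hr0' : (0 : ℝ) ≤ r := Nat.cast_nonneg r
      have hy' : (m : ℝ) + 2 * k - 2 - r = m₀ := by exact_mod_cast hy
      rw [thresholdP, if_neg (Nat.succ_ne_zero k₀), hy', mul_comm]
      push_cast
      refine mul_le_mul_of_nonpos_right ?_ hQ.le
      nlinarith
  · rcases ha hr with hy | ⟨hy, hrN⟩
    · refine hm₀_lt.trans_le ?_
      have key : (m + 2 * k + 1 - r) ^ 2 - ((r : ℤ) - 1) * r ≤ (m₀ + 1) ^ 2 := by nlinarith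
      have key' : ((m : ℝ) + 2 * k + 1 - r) ^ 2 - ((r : ℝ) - 1) * r ≤ ((m₀ : ℝ) + 1) ^ 2 := by
        exact_mod_cast key
      nlinarith
    · refine hk₀_lt.trans_le ?_
      have hr' : (N : ℝ) + 2 ≤ r + k₀ := by exact_mod_cast hrN
      have hk₀' : (k₀ : ℝ) ≤ N := by exact_mod_cast hk₀
      have hy' : (m : ℝ) + 2 * k + 1 - r = m₀ := by exact_mod_cast hy
      rw [thresholdP, if_neg (by omega), hy', mul_comm Q]
      refine mul_le_mul_of_nonpos_right ?_ hQ.le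
      nlinarith

theorem theorem4 (Q A B α β : ℝ) (hQ : Q < 0)
    (hα : α = 1 ∨ α = -1) (hβ : β = 1 ∨ β = -1)
    (N : ℕ) (m₀ : ℤ)
    (hm₀ : m₀ ≤ min (-3 * (N : ℤ) - 2) (-((N : ℤ) * ((N : ℤ) + 1) / 2) - 1))
    (hm₀_le : (m₀ : ℝ) ^ 2 * Q ≤ B - A) (hm₀_lt : B - A < ((m₀ : ℝ) + 1) ^ 2 * Q)
    (k₀ : ℕ) (hk₀ : k₀ ≤ N)
    (hk₀_le : thresholdP Q N m₀ (k₀ + 1) ≤ B - A) (hk₀_lt : B - A < thresholdP Q N m₀ k₀) :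
    -- (I)
    (∀ m : ℤ, m ≤ m₀ - 2 * N - 1 →
      HasPUltradiscreteLimit (detSolutionEps Q A B α β N m)
        1 ((-(m : ℝ) - 2 * N - 1) * Q)) ∧
    -- (II)
    (∀ m : ℤ, ∀ j : ℕ,
      (j + k₀ ≤ N → m = m₀ - 2 * N + 3 * j →
        HasPUltradiscreteLimit (detSolutionEps Q A B α β N m)
          (α * β * (-1) ^ j) (A - B + ((m₀ : ℝ) ^ 2 + m₀ - (j : ℝ) ^ 2) * Q)) ∧
      (j + k₀ ≤ N → m = m₀ - 2 * N + 3 * j + 1 →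
        HasPUltradiscreteLimit (detSolutionEps Q A B α β N m)
          1 (((m₀ : ℝ) + j + 1) * Q)) ∧
      (j + k₀ + 1 ≤ N → m = m₀ - 2 * N + 3 * j + 2 →
        HasPUltradiscreteLimit (detSolutionEps Q A B α β N m)
          (α * β * (-1) ^ j) (B - A - ((m₀ : ℝ) ^ 2 + m₀ - ((j : ℝ) + 1) ^ 2) * Q))) ∧
    -- (III)
    (k₀ ≠ 0 → ∀ m : ℤ, m = m₀ + N - 3 * k₀ + 2 →
      HasPUltradiscreteLimit (detSolutionEps Q A B α β N m)
        (-1) ((-(m₀ : ℝ) - N + k₀ - 1) * Q)) ∧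
    -- (IV)
    (k₀ ≠ 0 → ∀ m : ℤ, ∀ j : ℕ, N + 1 ≤ j + k₀ →
      (j ≤ N → m = m₀ - 2 * N + 3 * j →
        HasPUltradiscreteLimit (detSolutionEps Q A B α β N m)
          1 (((m₀ : ℝ) + j) * Q)) ∧
      (j + 1 ≤ N → m = m₀ - 2 * N + 3 * j + 1 →
        HasPUltradiscreteLimit (detSolutionEps Q A B α β N m)
          (α * β * (-1) ^ j) (B - A - ((m₀ : ℝ) ^ 2 - m₀ - ((j : ℝ) + 1) ^ 2) * Q)) ∧
      (j + 1 ≤ N → m = m₀ - 2 * N + 3 * j + 2 →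
        HasPUltradiscreteLimit (detSolutionEps Q A B α β N m)
          (α * β * (-1) ^ (j + 1))
          (A - B + ((m₀ : ℝ) ^ 2 - m₀ - ((j : ℝ) + 1) ^ 2) * Q))) ∧
    -- (V)
    (∀ m : ℤ, m₀ + N + 1 ≤ m → m ≤ -2 * N - 1 →
      HasPUltradiscreteLimit (detSolutionEps Q A B α β N m)
        1 ((m : ℝ) * Q)) := by
  have hm₂ : m₀ ≤ -3 * (N : ℤ) - 2 := hm₀.trans (min_le_left _ _)
  have hs := airySign_mul_self hα hβ
  have dom : ∀ (r k : ℕ) (m : ℤ), r + k ≤ N + 1 ∧ m + 2 * (r + k) ≤ 2 ∧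
      (0 < k → m + 2 * k - 2 - r < m₀ ∨ m + 2 * k - 2 - r = m₀ ∧ r + k₀ ≤ N) ∧
      (0 < r → m₀ < m + 2 * k + 1 - r ∨ m + 2 * k + 1 - r = m₀ ∧ N + 2 ≤ r + k₀) →
      BlockDominates Q A B r k m := fun r k m ⟨hrk, hm, hb, ha⟩ =>
    blockDominates_of_thresholds hQ hm₀ hm₀_le hm₀_lt hk₀ hk₀_le hk₀_lt hrk hm hb ha
  -- In each case it remains to name the numbers `r₁, r₂, r₃, r₄` of factors `q`-Ai in the
  -- dominating terms of `g^{(N)}(m)`, `g^{(N+1)}(m+1)`, `g^{(N)}(m+1)`, `g^{(N+1)}(m)`.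
  have lim : ∀ {m : ℤ} {ζ Z : ℝ} (r₁ r₂ r₃ r₄ k₁ k₂ k₃ k₄ : ℕ), m ≤ -2 * N - 1 →
      (r₁ + k₁ = N ∧ r₂ + k₂ = N + 1 ∧ r₃ + k₃ = N ∧ r₄ + k₄ = N + 1) →
      BlockDominates Q A B r₁ k₁ m → BlockDominates Q A B r₂ k₂ (m + 1) →
      BlockDominates Q A B r₃ k₃ (m + 1) → BlockDominates Q A B r₄ k₄ m →
      airySign α β r₁ * airySign α β r₂ * (airySign α β r₃ * airySign α β r₄) = ζ →
      blockExponent Q A B r₁ k₁ m + blockExponent Q A B r₂ k₂ (m + 1) -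
        (N * Q + blockExponent Q A B r₃ k₃ (m + 1) + blockExponent Q A B r₄ k₄ m) = Z →
      HasPUltradiscreteLimit (detSolutionEps Q A B α β N m) ζ Z :=
    fun r₁ r₂ r₃ r₄ _ _ _ _ hm ⟨h₁, h₂, h₃, h₄⟩ d₁ d₂ d₃ d₄ hζ hZ =>
      hasPUltradiscreteLimit_detSolutionEps hQ hα hβ hm r₁ r₂ r₃ r₄ h₁ h₂ h₃ h₄ d₁ d₂ d₃ d₄ hζ hZ
  refine ⟨fun m h => ?_, fun m j => ⟨fun hj h => ?_, fun hj h => ?_, fun hj h => ?_⟩,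
    fun hk m h => ?_, fun hk m j hjk => ⟨fun hj h => ?_, fun hj h => ?_, fun hj h => ?_⟩,
    fun m h h' => ?_⟩
  · refine lim 0 0 0 0 N (N + 1) N (N + 1) (by omega) (by omega) (dom _ _ _ (by omega))
      (dom _ _ _ (by omega)) (dom _ _ _ (by omega)) (dom _ _ _ (by omega)) ?_ ?_
    · simp [airySign]
    · simp only [blockExponent]
      push_cast
      ring
  · obtain ⟨d, rfl⟩ := Nat.exists_eq_add_of_le hj
    refine lim j (j + 1) j j (k₀ + d) (k₀ + d) (k₀ + d) (k₀ + d + 1) (by omega) (by omega)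
      (dom _ _ _ (by omega)) (dom _ _ _ (by omega)) (dom _ _ _ (by omega))
      (dom _ _ _ (by omega)) ?_ ?_
    · rw [airySign_succ]
      linear_combination (α * β * (-1) ^ j) * (airySign α β j ^ 2 + 1) * hs j
    · simp only [blockExponent, h]
      push_cast
      ring
  · obtain ⟨d, rfl⟩ := Nat.exists_eq_add_of_le hj
    refine lim j (j + 1) j (j + 1) (k₀ + d) (k₀ + d) (k₀ + d) (k₀ + d) (by omega) (by omega)
      (dom _ _ _ (by omega)) (dom _ _ _ (by omega)) (dom _ _ _ (by omega))
      (dom _ _ _ (by omega)) ?_ ?_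
    · linear_combination airySign α β (j + 1) ^ 2 * hs j + hs (j + 1)
    · simp only [blockExponent, h]
      push_cast
      ring
  · obtain ⟨d, rfl⟩ := Nat.exists_eq_add_of_le hj
    refine lim j (j + 1) (j + 1) (j + 1) (k₀ + d + 1) (k₀ + d + 1) (k₀ + d) (k₀ + d + 1)
      (by omega) (by omega) (dom _ _ _ (by omega)) (dom _ _ _ (by omega))
      (dom _ _ _ (by omega)) (dom _ _ _ (by omega)) ?_ ?_
    · linear_combination airySign α β j * airySign α β (j + 1) * hs (j + 1) +
        airySign α β j * airySign_succ α β j + α * β * (-1) ^ j * hs j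
    · simp only [blockExponent, h]
      push_cast
      ring
  · obtain ⟨l, rfl⟩ := Nat.exists_eq_succ_of_ne_zero hk
    obtain ⟨j, rfl⟩ := Nat.exists_eq_add_of_le hk₀
    refine lim j (j + 2) (j + 1) (j + 1) (l + 1) l l (l + 1) (by omega) (by omega)
      (dom _ _ _ (by omega)) (dom _ _ _ (by omega)) (dom _ _ _ (by omega))
      (dom _ _ _ (by omega)) ?_ ?_
    · have hαβ : α * β * (α * β) = 1 := by
        rw [mul_mul_mul_comm, mul_self_eq_one hα, mul_self_eq_one hβ, one_mul]
      rw [hs, mul_one, airySign_succ α β (j + 1), airySign_succ α β j, pow_succ]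
      linear_combination (-(α * β) ^ 2 * ((-1) ^ j) ^ 2) * hs j - ((-1) ^ j) ^ 2 * hαβ -
        mul_self_neg_one_pow j
    · simp only [blockExponent, h]
      push_cast
      ring
  · obtain ⟨d, rfl⟩ := Nat.exists_eq_add_of_le hj
    refine lim j (j + 1) j (j + 1) d d d d (by omega) (by omega)
      (dom _ _ _ (by omega)) (dom _ _ _ (by omega)) (dom _ _ _ (by omega))
      (dom _ _ _ (by omega)) ?_ ?_
    · linear_combination airySign α β (j + 1) ^ 2 * hs j + hs (j + 1)
    · simp only [blockExponent, h]
      push_cast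
      ring
  · obtain ⟨d, rfl⟩ := Nat.exists_eq_add_of_le hj
    refine lim j (j + 1) (j + 1) (j + 1) (d + 1) (d + 1) d (d + 1) (by omega) (by omega)
      (dom _ _ _ (by omega)) (dom _ _ _ (by omega)) (dom _ _ _ (by omega))
      (dom _ _ _ (by omega)) ?_ ?_
    · linear_combination airySign α β j * airySign α β (j + 1) * hs (j + 1) +
        airySign α β j * airySign_succ α β j + α * β * (-1) ^ j * hs j
    · simp only [blockExponent, h]
      push_cast
      ring
  · obtain ⟨d, rfl⟩ := Nat.exists_eq_add_of_le hj
    refine lim (j + 1) (j + 2) (j + 1) (j + 1) d d d (d + 1) (by omega) (by omega)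
      (dom _ _ _ (by omega)) (dom _ _ _ (by omega)) (dom _ _ _ (by omega))
      (dom _ _ _ (by omega)) ?_ ?_
    · rw [airySign_succ α β (j + 1)]
      linear_combination (α * β * (-1) ^ (j + 1)) * (airySign α β (j + 1) ^ 2 + 1) * hs (j + 1)
    · simp only [blockExponent, h]
      push_cast
      ring
  · refine lim N (N + 1) N (N + 1) 0 0 0 0 (by omega) (by omega)
      (dom _ _ _ (by omega)) (dom _ _ _ (by omega)) (dom _ _ _ (by omega))
      (dom _ _ _ (by omega)) ?_ ?_
    · linear_combination airySign α β (N + 1) ^ 2 * hs N + hs (N + 1)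
    · simp only [blockExponent]
      push_cast
      ring
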